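/- **Setting.** Let $\mathrm G$ be a strongly connected directed graph on $\mathrm V=\{1,\dots,n\}$ and $W$ a doubly stochastic $n\times n$ matrix with non-negative entries such that, for $j\neq i$, $W_{ij}>0$ if and only if $(j,i)$ is an edge of $\mathrm G$. Let $\sigma_2$ be the second largest singular value of $W$ ($\sigma_2=0$ if $n=1$). Let $\mathcal K\subset\mathbb R^m$ be compact and convex with $\mathbb B_r\subseteq\mathcal K\subseteq\mathbb B_R$, where $0<r\le R$ and $\mathbb B_\rho$ is the closed Euclidean ball of radius $\rho$ centred at $0$. An adaptive adversary chooses, in round $t$ at node $i$, a data point $(\mathbf h_i(t),z_i(t))\in\mathbb R^m\times\mathbb R$ with $\|\mathbf h_i(t)\|^2\le\alpha_{\mathbf h}$ and $|z_i(t)|\le\alpha_z$, as a (measurable) function of $(\mathbf h_i(s),z_i(s),\mathbf x_i(s))_{s<t}$. Write $\theta_{i,t}(\mathbf y)=\frac12(\mathbf h_i(t)^{\mathsf T}\mathbf y-z_i(t))^2$ and $L=\alpha_{\mathbf h}R+\sqrt{\alpha_{\mathbf h}}\,\alpha_z$. **Algorithm DOLR-BF-AA** with parameters $\beta=\frac12$,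 $\epsilon=T^{-1/2}$, $\kappa=1$, $\xi=\epsilon/r$. It starts from arbitrary $\mathbf x_i(1)\in\mathcal K$. In round $t$ each node $i$ draws a direction $\mathbf u_i(t)$ uniformly on the unit sphere of $\mathbb R^m$ (independently over nodes and rounds) and computes $$\mathbf g_i(t)=\frac{m}{2\epsilon}\big(\theta_{i,t}(\mathbf x_i(t)+\epsilon\mathbf u_i(t))-\theta_{i,t}(\mathbf x_i(t)-\epsilon\mathbf u_i(t))\big)\mathbf u_i(t),\qquad \mathbf l_i(t)=\mathbf x_i(t)-\frac{1}{\kappa T^{\beta}}\mathbf g_i(t);$$ then $\mathbf x_i(t+1)$ is the Euclidean projection of $\sum_{j}W_{ij}\,\mathbf l_j(t)$ onto $(1-\xi)\mathcal K$. The expected regret of node $i$ is $$\mathrm{Regret}(i,T)=\sum_{t=1}^{T}\sum_{j=1}^{n}\mathbb E[\theta_{j,t}(\mathbf x_i(t))]-\min_{\mathbf y\in\mathcal K}\sum_{t=1}^{T}\sum_{j=1}^{n}\mathbb E[\theta_{j,t}(\mathbf y)].$$ **Theorem.** If $W_{ii}>0$ for all $i$, then $\sigma_2<1$. Moreover, there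 is an absolute constant $C>0$ such that, whenever $\sigma_2<1$, all the expectations above are finite, and for all $i\in\mathrm V$ and all $T\ge\lceil 1/r^2\rceil$, $$\mathrm{Regret}(i,T)\le\tilde B_{\mathrm G}\sqrt T,\qquad \tilde B_{\mathrm G}=C\Big(\frac{\sigma_2}{1-\sigma_2}\,n^{3/2}\,(mL^2+LR)+n\Big(mL^2+R^2+\frac{LR}{r}\Big)\Big).$$ This constant satisfies $\tilde B_{\mathrm G}=\mathcal O\big(\frac{\sigma_2}{1-\sigma_2}n^{3/2}m^2L^3\big)$ in the following sense: for all $0<r\le R$ and $c>0$ there is $C'>0$, depending only on $r,R,c$, such that $\tilde B_{\mathrm G}\le C'\frac{\sigma_2}{1-\sigma_2}n^{3/2}m^2L^3$ for all $n$, $m\ge1$, $\sigma_2\in[0,1)$ and $L$ with $L\ge c$ and $\sqrt n\,\frac{\sigma_2}{1-\sigma_2}\ge c$. -/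

import Mathlib

open MeasureTheory ProbabilityTheory
open scoped Pointwise

noncomputable section

namespace DOLR

/-- Column vectors of length `m`, with the Euclidean norm. -/
abbrev Vec (m : ℕ) : Type := EuclideanSpace ℝ (Fin m)

/-- A data point: a covariate vector together with its outcome. -/
abbrev Datum (m : ℕ) : Type := Vec m × ℝ

/-- The square loss `θ(y) = (hᵀ y - z)² / 2` of the data point `d = (h, z)`. -/
def sqLoss {m : ℕ} (d : Datum m) (y : Vec m) : ℝ :=
  (1 / 2) * (inner ℝ d.1 y - d.2) ^ 2

/-! ### Network -/

/-- Every node can be reached from every node along directed edges. -/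
def StronglyConnected {n : ℕ} (G : Digraph (Fin n)) : Prop :=
  ∀ i j : Fin n, Relation.ReflTransGen G.Adj i j

/-- `W` is a doubly stochastic weight matrix on the directed graph `G`: off the diagonal,
`W i j` is positive exactly when `j` is an in-neighbour of `i`, i.e. `(j, i)` is an edge. -/
structure IsWeightMatrix {n : ℕ} (G : Digraph (Fin n)) (W : Matrix (Fin n) (Fin n) ℝ) :
    Prop where
  nonneg : ∀ i j, 0 ≤ W i j
  pos_iff : ∀ i j, j ≠ i → (0 < W i j ↔ G.Adj j i)
  row_sum : ∀ i, ∑ j, W i j = 1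
  col_sum : ∀ j, ∑ i, W i j = 1

/-- The second largest singular value (Mathlib's sequence of singular values is decreasing,
counts multiplicities, starts at index `0`, and is continued by zeros; so this is `0` for
a `1 × 1` matrix). -/
def sigma₂ {n : ℕ} (W : Matrix (Fin n) (Fin n) ℝ) : ℝ :=
  (Matrix.toEuclideanLin W).singularValues 1

/-! ### Adversary -/

/-- What has happened at one node during the first `t` rounds: for each round, the data point
and the prediction of the node. Rounds are numbered from `0`. -/
abbrev History (m t : ℕ) : Type := Fin t → Datum m × Vec m

/-- An adaptive adversary: the data point at node `i` in round `t` is a function of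
the data and the predictions at node `i` in the previous rounds. -/
abbrev Adversary (n m : ℕ) : Type := (i : Fin n) → (t : ℕ) → History m t → Datum m

/-- The set of data points that the adversary may use. -/
def dataSet (m : ℕ) (αh αz : ℝ) : Set (Datum m) :=
  {d | ‖d.1‖ ^ 2 ≤ αh ∧ |d.2| ≤ αz}

/-! ### Algorithm -/

/-- Euclidean projection of `x` onto `A`: a point of `A` at minimal distance from `x`
(there is exactly one if `A` is non-empty, closed and convex). -/
def proj {m : ℕ} (A : Set (Vec m)) (x : Vec m) : Vec m :=
  Classical.epsilon fun y => y ∈ A ∧ ∀ z ∈ A, ‖x - y‖ ≤ ‖x - z‖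

/-- The two-point gradient estimator at `x` in the random direction `u`. -/
def gradEst {m : ℕ} (ε : ℝ) (d : Datum m) (x u : Vec m) : Vec m :=
  ((m : ℝ) / (2 * ε) * (sqLoss d (x + ε • u) - sqLoss d (x - ε • u))) • u

/-- One run of the projected bandit algorithm against the adversary `A`, for the initial
predictions `x₁` and the realized directions `u t i`, with step size `η`: the predictions of all
the nodes in round `t`, and the history of each node before round `t`. -/
def run {n m : ℕ} (W : Matrix (Fin n) (Fin n) ℝ) (K : Set (Vec m)) (A : Adversary n m)
    (η ε ξ : ℝ) (x₁ : Fin n → Vec m) (u : ℕ → Fin n → Vec m) :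
    (t : ℕ) → (Fin n → Vec m) × (Fin n → History m t)
  | 0 => (x₁, fun _ => Fin.elim0)
  | t + 1 =>
    let x := (run W K A η ε ξ x₁ u t).1
    let past := (run W K A η ε ξ x₁ u t).2
    let d : Fin n → Datum m := fun i => A i t (past i)
    let l : Fin n → Vec m := fun i => x i - η • gradEst ε (d i) (x i) (u t i)
    (fun i => proj ((1 - ξ) • K) (∑ j, W i j • l j),
      fun i => Fin.snoc (past i) (d i, x i))

/-- The prediction of node `i` in round `t`. -/
def prediction {n m : ℕ} (W : Matrix (Fin n) (Fin n) ℝ) (K : Set (Vec m)) (A : Adversary n m)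
    (η ε ξ : ℝ) (x₁ : Fin n → Vec m) (u : ℕ → Fin n → Vec m) (t : ℕ) (i : Fin n) : Vec m :=
  (run W K A η ε ξ x₁ u t).1 i

/-- The data point of node `i` in round `t`. -/
def datum {n m : ℕ} (W : Matrix (Fin n) (Fin n) ℝ) (K : Set (Vec m)) (A : Adversary n m)
    (η ε ξ : ℝ) (x₁ : Fin n → Vec m) (u : ℕ → Fin n → Vec m) (t : ℕ) (i : Fin n) : Datum m :=
  A i t ((run W K A η ε ξ x₁ u t).2 i)

/-! ### Randomness and regret -/

/-- The uniform probability distribution on the unit sphere (normalized surface measure). -/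
def sphereUniform (m : ℕ) : Measure (Vec m) :=
  ((volume : Measure (Vec m)).toSphere Set.univ)⁻¹ •
    (volume : Measure (Vec m)).toSphere.map Subtype.val

/-- The directions `u t i` drawn by the nodes are independent (over rounds and nodes) and
uniformly distributed on the unit sphere. -/
structure IsUniformDirections {n m : ℕ} {Ω : Type*} [MeasurableSpace Ω] (P : Measure Ω)
    (u : ℕ → Fin n → Ω → Vec m) : Prop where
  measurable : ∀ t i, Measurable (u t i)
  law : ∀ t i, P.map (u t i) = sphereUniform m
  indep : iIndepFun (fun p : ℕ × Fin n => u p.1 p.2) P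

/-- The expected regret of node `i` after `T` rounds, for predictions `x t i` and data `d t i`
that are random: the expected cumulative network-wide loss of the predictions of node `i`, minus
the minimum over fixed `y ∈ K` of the expected cumulative network-wide loss of `y`. -/
def regret {n m : ℕ} {Ω : Type*} [MeasurableSpace Ω] (P : Measure Ω) (K : Set (Vec m))
    (x : ℕ → Fin n → Ω → Vec m) (d : ℕ → Fin n → Ω → Datum m) (T : ℕ) (i : Fin n) : ℝ :=
  (∑ t ∈ Finset.range T, ∑ j, ∫ ω, sqLoss (d t j ω) (x t i ω) ∂P) -
    sInf ((fun y => ∑ t ∈ Finset.range T, ∑ j, ∫ ω, sqLoss (d t j ω) y ∂P) '' K)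

/-- The factor of `√T` in the regret bound, up to an absolute constant. -/
def boundFactor (σ : ℝ) (n m : ℕ) (r R L : ℝ) : ℝ :=
  σ / (1 - σ) * (n : ℝ) ^ (3 / 2 : ℝ) * (m * L ^ 2 + L * R) +
    n * (m * L ^ 2 + R ^ 2 + L * R / r)

end DOLR

end

/-!
The regret of node `i` against a competitor `y ∈ K` splits into three parts.

*Disagreement.* By convexity, `θⱼ(xᵢ) - θⱼ(xⱼ) ≤ L ‖xᵢ - xⱼ‖`. The projection is nonexpansive, so
it does not increase any pairwise distance, and one mixing step contracts the `ℓ²` norm of all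
pairwise differences (`spread`) by `σ₂` (`IsWeightMatrix.spread_mix_le`). Since the gradient step
and the projection are on either side of the mixing, both the disagreement and the perturbation of
size `m L / √T` by the gradient estimates are multiplied by `σ₂` in each round, and the accumulated
disagreement carries the factor `σ₂ / (1 - σ₂)` (`IsBanditRun.ae_sum_norm_sub_le`).

*Linearized regret of each node at its own prediction.* The losses are quadratic, so the two-point
estimator equals `m ⟪∇θ, u⟫ u` (`gradEst_eq`). A uniform direction has covariance `1 / m` times the
identity and is independent of the current predictions and data, so the estimator is exactly
unbiased and has second moment at most `m L²`. As `W` is doubly stochastic, mixing does not increase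
`∑ᵢ ‖xᵢ - y'‖²`, nor does projecting if `y' = (1 - ξ) y` lies in the shrunken set; this quantity
telescopes as in ordinary projected gradient descent
(`IsBanditRun.sum_integral_inner_lossGrad_le`).

*Shrinking.* Replacing `y` by `(1 - ξ) y` costs at most `L ξ R` for each loss.

The claim about `σ₂` itself is the equality case of `‖W v‖ ≤ ‖v‖`: each row contributes a variance
(`IsWeightMatrix.sum_sq_gap`), so a vector that is not contracted is constant along every edge, hence
constant; two orthogonal singular vectors cannot both be constant (`sigma₂_lt_one`). Conversely, if
`σ₂ < 1`, the constant vectors span the leading singular space, and `W` contracts their orthogonal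
complement by `σ₂` (`IsWeightMatrix.sum_sq_le_of_sum_eq_zero`).
-/

namespace DOLR

/-! ### Doubly stochastic matrices and their second singular value -/

open Matrix in
/-- The loss of squared norm under `W` is the sum over the rows `i` of the variance of `v` under the
weights `W i j`. -/
lemma IsWeightMatrix.sum_sq_gap {n : ℕ} {G : Digraph (Fin n)} {W : Matrix (Fin n) (Fin n) ℝ}
    (hW : IsWeightMatrix G W) (v : Fin n → ℝ) :
    ∑ i, ∑ j, W i j * (v j - (W *ᵥ v) i) ^ 2 = ∑ j, v j ^ 2 - ∑ i, (W *ᵥ v) i ^ 2 := by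
  have key : ∀ i, ∑ j, W i j * (v j - (W *ᵥ v) i) ^ 2
      = ∑ j, W i j * v j ^ 2 - (W *ᵥ v) i ^ 2 := by
    intro i
    have hmean : ∑ j, W i j * v j = (W *ᵥ v) i := rfl
    have hexp : ∀ j, W i j * (v j - (W *ᵥ v) i) ^ 2
        = W i j * v j ^ 2 - 2 * (W *ᵥ v) i * (W i j * v j) + (W *ᵥ v) i ^ 2 * W i j :=
      fun j => by ring
    simp_rw [hexp]
    rw [Finset.sum_add_distrib, Finset.sum_sub_distrib, ← Finset.mul_sum, ← Finset.mul_sum,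
      hW.row_sum, hmean]
    ring
  simp_rw [key]
  rw [Finset.sum_sub_distrib, Finset.sum_comm]
  simp_rw [← Finset.sum_mul, hW.col_sum, one_mul]

open Matrix in
/-- Equality in `∑ (W v)ᵢ² ≤ ∑ vⱼ²` forces `v` to be constant, as soon as the graph is strongly
connected and every node gives itself positive weight. -/
lemma IsWeightMatrix.eq_of_sum_sq_le {n : ℕ} {G : Digraph (Fin n)}
    {W : Matrix (Fin n) (Fin n) ℝ} (hG : StronglyConnected G) (hW : IsWeightMatrix G W)
    (hd : ∀ i, 0 < W i i) (v : Fin n → ℝ) (hv : ∑ j, v j ^ 2 ≤ ∑ i, (W *ᵥ v) i ^ 2)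
    (i j : Fin n) : v i = v j := by
  have h0 : ∀ i j, 0 ≤ W i j * (v j - (W *ᵥ v) i) ^ 2 :=
    fun i j => mul_nonneg (hW.nonneg i j) (sq_nonneg _)
  have hle : ∑ i, ∑ j, W i j * (v j - (W *ᵥ v) i) ^ 2 = 0 :=
    le_antisymm (by rw [hW.sum_sq_gap]; linarith)
      (Finset.sum_nonneg fun i _ => Finset.sum_nonneg fun j _ => h0 i j)
  rw [Finset.sum_eq_zero_iff_of_nonneg
    (fun i _ => Finset.sum_nonneg fun j _ => h0 i j)] at hle
  have hz : ∀ i j, 0 < W i j → v j = (W *ᵥ v) i := by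
    intro i j hij
    have h1 := (Finset.sum_eq_zero_iff_of_nonneg (fun j _ => h0 i j)).1
      (hle i (Finset.mem_univ i)) j (Finset.mem_univ j)
    rcases mul_eq_zero.1 h1 with h | h
    · exact absurd h hij.ne'
    · exact sub_eq_zero.1 (pow_eq_zero_iff two_ne_zero |>.1 h)
  have hedge : ∀ a b, G.Adj a b → v a = v b := by
    intro a b hab
    rcases eq_or_ne a b with rfl | hne
    · rfl
    · rw [hz b a ((hW.pos_iff b a hne).2 hab), hz b b (hd b)]
  have hpath := hG i j
  induction hpath with
  | refl => rfl
  | tail _ h ih => exact ih.trans (hedge _ _ h)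

lemma sigma₂_nonneg {n : ℕ} (W : Matrix (Fin n) (Fin n) ℝ) : 0 ≤ sigma₂ W :=
  LinearMap.singularValues_nonneg _ _

/-- The squared norm of the image of a right singular vector. -/
lemma norm_sq_apply_eigenvectorBasis {n : ℕ}
    (T : EuclideanSpace ℝ (Fin n) →ₗ[ℝ] EuclideanSpace ℝ (Fin n)) (i : Fin n) :
    ‖T (T.isSymmetric_adjoint_comp_self.eigenvectorBasis finrank_euclideanSpace_fin i)‖ ^ 2
      = T.singularValues i ^ 2 := by
  set b := T.isSymmetric_adjoint_comp_self.eigenvectorBasis finrank_euclideanSpace_fin with hb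
  have h := T.isSymmetric_adjoint_comp_self.apply_eigenvectorBasis finrank_euclideanSpace_fin i
  rw [T.sq_singularValues_fin finrank_euclideanSpace_fin, ← real_inner_self_eq_norm_sq,
    ← LinearMap.adjoint_inner_left]
  rw [LinearMap.comp_apply] at h
  rw [h, ← hb, real_inner_smul_left, real_inner_self_eq_norm_sq, b.orthonormal.1 i]
  simp

theorem sigma₂_lt_one {n : ℕ} {G : Digraph (Fin n)} {W : Matrix (Fin n) (Fin n) ℝ}
    (hG : StronglyConnected G) (hW : IsWeightMatrix G W) (hd : ∀ i, 0 < W i i) :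
    sigma₂ W < 1 := by
  by_contra! hσ
  have hn : 1 < n := by
    by_contra! hn
    have : sigma₂ W = 0 := LinearMap.singularValues_of_finrank_le _ (by simpa using hn)
    linarith
  set T := Matrix.toEuclideanLin W with hT
  set b := T.isSymmetric_adjoint_comp_self.eigenvectorBasis finrank_euclideanSpace_fin with hb
  -- the two leading right singular vectors are not contracted, hence both are constant
  have hconst : ∀ i : Fin n, (i : ℕ) ≤ 1 → ∀ k l, b i k = b i l := by
    intro i hi
    refine hW.eq_of_sum_sq_le hG hd _ ?_
    have h1 : 1 ≤ T.singularValues i := hσ.trans (T.singularValues_antitone hi)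
    have h2 : ‖b i‖ ^ 2 ≤ ‖T (b i)‖ ^ 2 := by
      rw [hb, norm_sq_apply_eigenvectorBasis, ← hb, b.orthonormal.1 i]
      nlinarith
    simpa only [EuclideanSpace.real_norm_sq_eq, hT, Matrix.toLpLin_apply] using h2
  have hne : ∀ i : Fin n, (i : ℕ) ≤ 1 → b i ⟨0, by omega⟩ ≠ 0 := by
    intro i hi h0
    have h1 : ‖b i‖ = 1 := b.orthonormal.1 i
    have h2 : b i = 0 := by
      ext k
      rw [hconst i hi k ⟨0, by omega⟩, h0]; rfl
    rw [h2, norm_zero] at h1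
    exact zero_ne_one h1
  have horth : inner ℝ (b ⟨0, by omega⟩) (b ⟨1, hn⟩) = 0 :=
    b.orthonormal.2 (by simp)
  rw [PiLp.inner_apply] at horth
  have hsum : ∀ k, inner ℝ (b ⟨0, by omega⟩ k) (b ⟨1, hn⟩ k)
      = b ⟨0, by omega⟩ ⟨0, by omega⟩ * b ⟨1, hn⟩ ⟨0, by omega⟩ := by
    intro k
    rw [hconst ⟨0, by omega⟩ (by simp) k ⟨0, by omega⟩, hconst ⟨1, hn⟩ (by simp) k ⟨0, by omega⟩]
    simp [mul_comm]
  rw [Finset.sum_congr rfl fun k _ => hsum k, Finset.sum_const, smul_eq_zero] at horth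
  rcases horth with h | h
  · simp at h; omega
  · exact mul_ne_zero (hne _ (by simp)) (hne _ (by simp)) h

open Matrix in
/-- A doubly stochastic matrix whose second singular value is less than `1` contracts the vectors
of sum zero by that value: the constant vectors carry the only singular value `1`. -/
lemma IsWeightMatrix.sum_sq_le_of_sum_eq_zero {n : ℕ} {G : Digraph (Fin n)}
    {W : Matrix (Fin n) (Fin n) ℝ} (hW : IsWeightMatrix G W) (hσ : sigma₂ W < 1)
    (v : Fin n → ℝ) (hv : ∑ j, v j = 0) :
    ∑ i, (W *ᵥ v) i ^ 2 ≤ sigma₂ W ^ 2 * ∑ j, v j ^ 2 := by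
  obtain _ | n := n
  · simp
  set T := Matrix.toEuclideanLin W with hT
  set b := T.isSymmetric_adjoint_comp_self.eigenvectorBasis finrank_euclideanSpace_fin with hb
  have hbT : ∀ i w, inner ℝ (T (b i)) (T w) = T.singularValues i ^ 2 * inner ℝ (b i) w := by
    intro i w
    have h := T.isSymmetric_adjoint_comp_self.apply_eigenvectorBasis finrank_euclideanSpace_fin i
    rw [LinearMap.comp_apply] at h
    rw [T.sq_singularValues_fin finrank_euclideanSpace_fin, ← LinearMap.adjoint_inner_left, h,
      real_inner_smul_left]
    rfl
  let e : EuclideanSpace ℝ (Fin (n + 1)) := WithLp.toLp 2 fun _ => 1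
  have hinner : ∀ w : EuclideanSpace ℝ (Fin (n + 1)), inner ℝ w e = ∑ k, w k := by
    intro w
    simp [PiLp.inner_apply, e]
  have hTe : T e = e := by
    ext k
    simp [hT, e, Matrix.toLpLin_apply, Matrix.mulVec, dotProduct, hW.row_sum]
  have hTsum : ∀ w : EuclideanSpace ℝ (Fin (n + 1)), inner ℝ (T w) e = inner ℝ w e := by
    intro w
    rw [hinner, hinner]
    simp only [hT, Matrix.toLpLin_apply, Matrix.mulVec, dotProduct]
    rw [Finset.sum_comm]
    simp_rw [← Finset.sum_mul, hW.col_sum, one_mul]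
  have hle : ∀ i : Fin (n + 1), i ≠ 0 → T.singularValues (i : ℕ) ≤ sigma₂ W := by
    intro i hi
    exact T.singularValues_antitone (Nat.one_le_iff_ne_zero.2 fun h => hi (Fin.ext h))
  -- `e` is fixed by `Wᵀ W`, so it is orthogonal to the eigenvectors of eigenvalues less than `1`
  have horth : ∀ i : Fin (n + 1), i ≠ 0 → inner ℝ (b i) e = 0 := by
    intro i hi
    have h := hbT i e
    rw [hTe, hTsum] at h
    have h1 : T.singularValues i < 1 := (hle i hi).trans_lt hσ
    have h2 := T.singularValues_nonneg i
    have h3 : (1 - T.singularValues i ^ 2) * inner ℝ (b i) e = 0 := by linarith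
    exact (mul_eq_zero.1 h3).resolve_left (by nlinarith)
  have hve : inner ℝ (WithLp.toLp 2 v) e = 0 := by rw [hinner]; exact hv
  have he : e ≠ 0 := by
    intro h
    have : e 0 = 0 := by rw [h]; rfl
    simp [e] at this
  have hsingle : ∀ w, inner ℝ w e = inner ℝ w (b 0) * inner ℝ (b 0) e := by
    intro w
    rw [← b.sum_inner_mul_inner w e]
    exact Fintype.sum_eq_single 0 fun i hi => by rw [horth i hi, mul_zero]
  have h0 : inner ℝ (b 0) (WithLp.toLp 2 v) = 0 := by
    have h := hsingle (WithLp.toLp 2 v)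
    rw [hve] at h
    rcases mul_eq_zero.1 h.symm with h | h
    · rw [real_inner_comm]; exact h
    · exfalso
      have := hsingle e
      rw [h, mul_zero] at this
      exact he (inner_self_eq_zero.1 this)
  have hnorm : ‖T (WithLp.toLp 2 v)‖ ^ 2
      = ∑ i : Fin (n + 1), T.singularValues i ^ 2 * inner ℝ (b i) (WithLp.toLp 2 v) ^ 2 := by
    have hexp := b.sum_repr' (WithLp.toLp 2 v)
    rw [← real_inner_self_eq_norm_sq]
    nth_rewrite 1 [← hexp]
    rw [map_sum, sum_inner]
    refine Finset.sum_congr rfl fun i _ => ?_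
    rw [map_smul, real_inner_smul_left, hbT]
    ring
  have hfin : ‖T (WithLp.toLp 2 v)‖ ^ 2
      ≤ sigma₂ W ^ 2 * ‖(WithLp.toLp 2 v : EuclideanSpace ℝ _)‖ ^ 2 := by
    rw [hnorm, ← b.sum_sq_inner_right, Finset.mul_sum]
    refine Finset.sum_le_sum fun i _ => ?_
    rcases eq_or_ne i 0 with rfl | hi
    · simp [h0]
    · gcongr
      · exact T.singularValues_nonneg _
      · exact hle i hi
  simpa [EuclideanSpace.real_norm_sq_eq, hT, Matrix.toLpLin_apply] using hfin

/-! ### Disagreement between the nodes -/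

/-- The disagreement of a family of vectors: the `ℓ²` norm of the family of all their pairwise
differences. -/
noncomputable def spread {n m : ℕ} (x : Fin n → Vec m) : ℝ :=
  ‖(WithLp.toLp 2 fun p : Fin n × Fin n => x p.1 - x p.2 : PiLp 2 fun _ => Vec m)‖

lemma spread_nonneg {n m : ℕ} (x : Fin n → Vec m) : 0 ≤ spread x := norm_nonneg _

lemma spread_sq {n m : ℕ} (x : Fin n → Vec m) :
    spread x ^ 2 = ∑ i, ∑ j, ‖x i - x j‖ ^ 2 := by
  rw [spread, PiLp.norm_sq_eq_of_L2, Fintype.sum_prod_type]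

lemma spread_sub_smul_le {n m : ℕ} (x g : Fin n → Vec m) {η : ℝ} (hη : 0 ≤ η) :
    spread (fun i => x i - η • g i) ≤ spread x + η * spread g := by
  have h : (WithLp.toLp 2 fun p : Fin n × Fin n => (x p.1 - η • g p.1) - (x p.2 - η • g p.2) :
      PiLp 2 fun _ => Vec m) = (WithLp.toLp 2 fun p : Fin n × Fin n => x p.1 - x p.2)
        - η • (WithLp.toLp 2 fun p : Fin n × Fin n => g p.1 - g p.2) := by
    ext p k
    simp
    ring
  rw [spread, h]
  refine (norm_sub_le _ _).trans_eq ?_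
  rw [norm_smul, Real.norm_of_nonneg hη]
  rfl

lemma spread_le_spread {n m : ℕ} {x y : Fin n → Vec m}
    (h : ∀ i j, ‖x i - x j‖ ≤ ‖y i - y j‖) : spread x ≤ spread y := by
  refine le_of_sq_le_sq ?_ (spread_nonneg y)
  rw [spread_sq, spread_sq]
  gcongr with i _ j _
  exact h i j

lemma spread_le_of_norm_le {n m : ℕ} {x : Fin n → Vec m} {B : ℝ} (h : ∀ i, ‖x i‖ ≤ B) :
    spread x ≤ 2 * n * B := by
  obtain _ | n := n
  · simp [spread, PiLp.norm_eq_of_L2]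
  have hB : 0 ≤ B := (norm_nonneg _).trans (h 0)
  refine le_of_sq_le_sq ?_ (by positivity)
  rw [spread_sq]
  calc ∑ i, ∑ j, ‖x i - x j‖ ^ 2 ≤ ∑ _i : Fin (n + 1), ∑ _j : Fin (n + 1), (B + B) ^ 2 := by
        gcongr with i _ j _
        exact (norm_sub_le _ _).trans (add_le_add (h i) (h j))
    _ = _ := by simp; ring

lemma sum_norm_sub_le_spread {n m : ℕ} (x : Fin n → Vec m) (i : Fin n) :
    ∑ j, ‖x i - x j‖ ≤ √n * spread x := by
  refine le_of_sq_le_sq ?_ (mul_nonneg (Real.sqrt_nonneg _) (spread_nonneg _))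
  calc (∑ j, ‖x i - x j‖) ^ 2 ≤ n * ∑ j, ‖x i - x j‖ ^ 2 := by
        simpa using sq_sum_le_card_mul_sum_sq (s := Finset.univ) (f := fun j => ‖x i - x j‖)
    _ ≤ n * ∑ i, ∑ j, ‖x i - x j‖ ^ 2 := by
        refine mul_le_mul_of_nonneg_left ?_ (Nat.cast_nonneg n)
        exact Finset.single_le_sum (f := fun i => ∑ j, ‖x i - x j‖ ^ 2)
          (fun _ _ => Finset.sum_nonneg fun _ _ => sq_nonneg _) (Finset.mem_univ i)
    _ = _ := by rw [mul_pow, Real.sq_sqrt (Nat.cast_nonneg n), spread_sq]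

open Matrix in
lemma IsWeightMatrix.sum_sq_sub_le {n : ℕ} {G : Digraph (Fin n)}
    {W : Matrix (Fin n) (Fin n) ℝ} (hW : IsWeightMatrix G W) (hσ : sigma₂ W < 1)
    (v : Fin n → ℝ) :
    ∑ i, ∑ j, ((W *ᵥ v) i - (W *ᵥ v) j) ^ 2
      ≤ sigma₂ W ^ 2 * ∑ i, ∑ j, (v i - v j) ^ 2 := by
  rcases Nat.eq_zero_or_pos n with rfl | hn
  · simp
  have hn' : (n : ℝ) ≠ 0 := by positivity
  -- for a vector of sum zero the sum over the pairs is `2 n` times its squared norm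
  have hpair : ∀ w : Fin n → ℝ, ∑ j, w j = 0 →
      ∑ i, ∑ j, (w i - w j) ^ 2 = 2 * n * ∑ j, w j ^ 2 := by
    intro w hw
    have hexp : ∀ i j, (w i - w j) ^ 2 = w i ^ 2 - 2 * w i * w j + w j ^ 2 := fun i j => by ring
    simp_rw [hexp, Finset.sum_add_distrib, Finset.sum_sub_distrib, ← Finset.mul_sum, hw]
    simp [← Finset.mul_sum]
    ring
  -- both sides are unchanged when the mean of `v` is subtracted
  set c : ℝ := (∑ j, v j) / n with hc
  set w : Fin n → ℝ := fun i => v i - c with hw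
  have hw0 : ∑ j, w j = 0 := by
    simp [hw, hc]
    field_simp
    simp
  have hWw : ∀ i, (W *ᵥ w) i = (W *ᵥ v) i - c := by
    intro i
    simp [hw, Matrix.mulVec, dotProduct, mul_sub, ← Finset.sum_mul, hW.row_sum]
  have hWw0 : ∑ i, (W *ᵥ w) i = 0 := by
    rw [← hw0]
    simp only [Matrix.mulVec, dotProduct]
    rw [Finset.sum_comm]
    simp_rw [← Finset.sum_mul, hW.col_sum, one_mul]
  have h1 : ∑ i, ∑ j, (v i - v j) ^ 2 = 2 * n * ∑ j, w j ^ 2 := by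
    rw [← hpair w hw0]
    simp [hw]
  have h2 : ∑ i, ∑ j, ((W *ᵥ v) i - (W *ᵥ v) j) ^ 2 = 2 * n * ∑ j, (W *ᵥ w) j ^ 2 := by
    rw [← hpair _ hWw0]
    simp [hWw]
  rw [h1, h2]
  calc 2 * n * ∑ j, (W *ᵥ w) j ^ 2 ≤ 2 * n * (sigma₂ W ^ 2 * ∑ j, w j ^ 2) := by
        gcongr
        exact hW.sum_sq_le_of_sum_eq_zero hσ w hw0
    _ = _ := by ring

lemma IsWeightMatrix.spread_mix_le {n m : ℕ} {G : Digraph (Fin n)}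
    {W : Matrix (Fin n) (Fin n) ℝ} (hW : IsWeightMatrix G W) (hσ : sigma₂ W < 1)
    (l : Fin n → Vec m) :
    spread (fun i => ∑ j, W i j • l j) ≤ sigma₂ W * spread l := by
  refine le_of_sq_le_sq ?_ (mul_nonneg (sigma₂_nonneg W) (spread_nonneg l))
  have hcoord : ∀ x : Fin n → Vec m,
      spread x ^ 2 = ∑ k, ∑ i, ∑ j, (x i k - x j k) ^ 2 := by
    intro x
    rw [spread_sq]
    simp_rw [EuclideanSpace.real_norm_sq_eq]
    rw [Finset.sum_comm (s := (Finset.univ : Finset (Fin m)))]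
    refine Finset.sum_congr rfl fun i _ => ?_
    rw [Finset.sum_comm]
    rfl
  rw [mul_pow, hcoord, hcoord, Finset.mul_sum]
  refine Finset.sum_le_sum fun k _ => ?_
  have h := hW.sum_sq_sub_le hσ fun j => l j k
  simpa [Matrix.mulVec, dotProduct] using h

lemma IsWeightMatrix.sum_norm_sq_mix_le {n m : ℕ} {G : Digraph (Fin n)}
    {W : Matrix (Fin n) (Fin n) ℝ} (hW : IsWeightMatrix G W) (l : Fin n → Vec m) :
    ∑ i, ‖∑ j, W i j • l j‖ ^ 2 ≤ ∑ j, ‖l j‖ ^ 2 := by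
  have hcoord : ∀ x : Fin n → Vec m, ∑ i, ‖x i‖ ^ 2 = ∑ k, ∑ i, x i k ^ 2 := by
    intro x
    simp_rw [EuclideanSpace.real_norm_sq_eq]
    exact Finset.sum_comm
  rw [hcoord, hcoord]
  refine Finset.sum_le_sum fun k _ => ?_
  have h := hW.sum_sq_gap fun j => l j k
  have h0 : 0 ≤ ∑ i, ∑ j, W i j * (l j k - (W.mulVec fun j => l j k) i) ^ 2 :=
    Finset.sum_nonneg fun i _ => Finset.sum_nonneg fun j _ =>
      mul_nonneg (hW.nonneg i j) (sq_nonneg _)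
  have h1 : ∀ i, (∑ j, W i j • l j) k = (W.mulVec fun j => l j k) i := by
    intro i
    simp [Matrix.mulVec, dotProduct]
  simp_rw [h1]
  linarith

/-! ### Euclidean projection -/

section Proj

variable {m : ℕ} {A : Set (Vec m)}

lemma proj_spec (hne : A.Nonempty) (hcl : IsClosed A) (hconv : Convex ℝ A) (x : Vec m) :
    proj A x ∈ A ∧ ∀ z ∈ A, ‖x - proj A x‖ ≤ ‖x - z‖ := by
  refine Classical.epsilon_spec (p := fun y => y ∈ A ∧ ∀ z ∈ A, ‖x - y‖ ≤ ‖x - z‖) ?_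
  obtain ⟨y, hy, hmin⟩ := exists_norm_eq_iInf_of_complete_convex hne hcl.isComplete hconv x
  refine ⟨y, hy, fun z hz => ?_⟩
  rw [hmin]
  exact ciInf_le ⟨0, Set.forall_mem_range.2 fun _ => norm_nonneg _⟩ (⟨z, hz⟩ : A)

lemma inner_sub_proj_le_zero (hne : A.Nonempty) (hcl : IsClosed A) (hconv : Convex ℝ A)
    (x : Vec m) {z : Vec m} (hz : z ∈ A) : inner ℝ (x - proj A x) (z - proj A x) ≤ 0 := by
  obtain ⟨hmem, hmin⟩ := proj_spec hne hcl hconv x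
  refine (norm_eq_iInf_iff_real_inner_le_zero hconv hmem).1 ?_ z hz
  have : Nonempty A := ⟨⟨_, hmem⟩⟩
  exact le_antisymm (le_ciInf fun w => hmin w w.2)
    (ciInf_le ⟨0, Set.forall_mem_range.2 fun _ => norm_nonneg _⟩ (⟨_, hmem⟩ : A))

lemma norm_proj_sub_proj_le (hne : A.Nonempty) (hcl : IsClosed A) (hconv : Convex ℝ A)
    (x y : Vec m) : ‖proj A x - proj A y‖ ≤ ‖x - y‖ := by
  set p := proj A x with hp
  set q := proj A y with hq
  have h1 := inner_sub_proj_le_zero hne hcl hconv x (proj_spec hne hcl hconv y).1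
  have h2 := inner_sub_proj_le_zero hne hcl hconv y (proj_spec hne hcl hconv x).1
  rw [← hp, ← hq] at h1 h2
  have h3 : ‖p - q‖ ^ 2 ≤ inner ℝ (x - y) (p - q) := by
    have e : inner ℝ (x - y) (p - q)
        = ‖p - q‖ ^ 2 - inner ℝ (x - p) (q - p) - inner ℝ (y - q) (p - q) := by
      rw [← real_inner_self_eq_norm_sq]
      simp only [inner_sub_left, inner_sub_right]
      ring
    linarith
  have h4 := h3.trans (real_inner_le_norm _ _)
  by_contra! h
  nlinarith [norm_nonneg (x - y), norm_nonneg (p - q)]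

lemma proj_eq_self {x : Vec m} (hcl : IsClosed A) (hconv : Convex ℝ A) (hx : x ∈ A) :
    proj A x = x := by
  have h := (proj_spec ⟨x, hx⟩ hcl hconv x).2 x hx
  rw [sub_self, norm_zero] at h
  exact (sub_eq_zero.1 (norm_le_zero_iff.1 h)).symm

lemma norm_proj_sub_le (hcl : IsClosed A) (hconv : Convex ℝ A) (x : Vec m) {y : Vec m}
    (hy : y ∈ A) : ‖proj A x - y‖ ≤ ‖x - y‖ := by
  have h := norm_proj_sub_proj_le ⟨y, hy⟩ hcl hconv x y
  rwa [proj_eq_self hcl hconv hy] at h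

lemma continuous_proj (hne : A.Nonempty) (hcl : IsClosed A) (hconv : Convex ℝ A) :
    Continuous (proj A) :=
  (LipschitzWith.of_dist_le_mul (K := 1) fun x y => by
    simpa [dist_eq_norm] using norm_proj_sub_proj_le hne hcl hconv x y).continuous

end Proj

/-! ### The uniform distribution on the sphere -/

lemma sphereUniform_apply {m : ℕ} {s : Set (Vec m)} (hs : MeasurableSet s) :
    sphereUniform m s = ((volume : Measure (Vec m)).toSphere Set.univ)⁻¹ *
      (Module.finrank ℝ (Vec m) *
        volume (Set.Ioo (0 : ℝ) 1 • (s ∩ Metric.sphere (0 : Vec m) 1))) := by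
  rw [sphereUniform, Measure.smul_apply, Measure.map_apply measurable_subtype_coe hs,
    Measure.toSphere_apply' _ (measurable_subtype_coe hs), smul_eq_mul,
    Subtype.image_preimage_coe, Set.inter_comm]

lemma sphereUniform_map_isometry {m : ℕ} (e : Vec m ≃ₗᵢ[ℝ] Vec m) :
    (sphereUniform m).map e = sphereUniform m := by
  ext s hs
  have hem : Measurable e := e.continuous.measurable
  rw [Measure.map_apply hem hs, sphereUniform_apply (hem hs), sphereUniform_apply hs]
  congr 2
  rw [← e.measurePreserving.measure_preimage_emb e.toHomeomorph.measurableEmbedding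
    (Set.Ioo (0 : ℝ) 1 • (s ∩ Metric.sphere (0 : Vec m) 1))]
  congr 1
  ext v
  simp only [Set.mem_smul, Set.mem_inter_iff, Set.mem_preimage, mem_sphere_zero_iff_norm]
  constructor
  · rintro ⟨c, hc, y, ⟨hy, hy1⟩, rfl⟩
    exact ⟨c, hc, e y, ⟨hy, by simpa using hy1⟩, by simp⟩
  · rintro ⟨c, hc, y, ⟨hy, hy1⟩, h⟩
    refine ⟨c, hc, e.symm y, ⟨by simpa using hy, by simpa using hy1⟩, ?_⟩
    rw [← map_smul, h, LinearIsometryEquiv.symm_apply_apply]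

lemma ae_norm_eq_one_sphereUniform (m : ℕ) : ∀ᵐ v ∂sphereUniform m, ‖v‖ = 1 := by
  have hs : MeasurableSet {v : Vec m | ¬ ‖v‖ = 1} :=
    (measurableSet_eq_fun measurable_norm measurable_const).compl
  rw [ae_iff, sphereUniform_apply hs]
  have : {v : Vec m | ¬ ‖v‖ = 1} ∩ Metric.sphere (0 : Vec m) 1 = ∅ := by
    ext v; simp
  simp [this]

lemma integrable_coord_mul_sphereUniform {m : ℕ} [IsProbabilityMeasure (sphereUniform m)]
    (k l : Fin m) : Integrable (fun v => v k * v l) (sphereUniform m) := by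
  refine Integrable.of_bound (C := 1) (by fun_prop) ?_
  filter_upwards [ae_norm_eq_one_sphereUniform m] with v hv
  have h : ∀ k, ‖v k‖ ≤ 1 := fun k => hv ▸ PiLp.norm_apply_le v k
  rw [norm_mul]
  exact mul_le_one₀ (h k) (norm_nonneg _) (h l)

/-- The covariance matrix of the uniform distribution on the sphere is `1 / m` times the identity:
changing the sign of one coordinate shows that the off-diagonal entries vanish, exchanging two
coordinates that the diagonal ones are equal. -/
lemma integral_coord_mul_sphereUniform {m : ℕ} [IsProbabilityMeasure (sphereUniform m)]
    (k l : Fin m) :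
    ∫ v, v k * v l ∂sphereUniform m = if k = l then 1 / (m : ℝ) else 0 := by
  have hinv : ∀ (e : Vec m ≃ₗᵢ[ℝ] Vec m) (k l : Fin m),
      ∫ v, v k * v l ∂sphereUniform m = ∫ v, (e v) k * (e v) l ∂sphereUniform m := by
    intro e k l
    conv_lhs => rw [← sphereUniform_map_isometry e]
    exact integral_map e.continuous.measurable.aemeasurable (by fun_prop)
  split_ifs with hkl
  · subst hkl
    have hdiag : ∀ l, ∫ v, v l * v l ∂sphereUniform m = ∫ v, v k * v k ∂sphereUniform m := by
      intro l
      rw [hinv (LinearIsometryEquiv.piLpCongrLeft 2 ℝ ℝ (Equiv.swap k l)) l l]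
      simp [LinearIsometryEquiv.piLpCongrLeft_apply, Equiv.piCongrLeft']
    have hsum : ∑ l, ∫ v, v l * v l ∂sphereUniform m = 1 := by
      rw [← integral_finsetSum _ fun l _ => integrable_coord_mul_sphereUniform l l]
      have : ∀ᵐ v ∂sphereUniform m, ∑ l, v l * v l = (1 : ℝ) := by
        filter_upwards [ae_norm_eq_one_sphereUniform m] with v hv
        have h := EuclideanSpace.real_norm_sq_eq v
        rw [hv] at h
        simp_rw [← sq]
        linarith
      rw [integral_congr_ae this]
      simp
    rw [Finset.sum_congr rfl fun l _ => hdiag l] at hsum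
    have hm : (m : ℝ) ≠ 0 := by
      have := k.pos
      positivity
    simp at hsum
    rw [eq_div_iff hm, mul_comm]
    exact hsum
  · let e : Vec m ≃ₗᵢ[ℝ] Vec m := LinearIsometryEquiv.piLpCongrRight 2 fun i =>
      if i = k then LinearIsometryEquiv.neg ℝ else LinearIsometryEquiv.refl ℝ ℝ
    have h := hinv e k l
    have h1 : ∀ v : Vec m, (e v) k * (e v) l = - (v k * v l) := by
      intro v
      simp [e, Ne.symm hkl]
    simp_rw [h1, integral_neg] at h
    linarith

/-- Averaging over a uniform direction `v` that is independent of the vectors `a` and `b`. -/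
lemma integral_inner_mul_inner_sphereUniform {m : ℕ} {Ω : Type*} [MeasurableSpace Ω]
    {P : Measure Ω} [IsProbabilityMeasure P] {a b v : Ω → Vec m} {Ca Cb : ℝ}
    (ha : Measurable a) (hb : Measurable b) (hv : Measurable v)
    (hab : ∀ ω, ‖a ω‖ ≤ Ca) (hbb : ∀ ω, ‖b ω‖ ≤ Cb)
    (hlaw : P.map v = sphereUniform m) (hind : IndepFun (fun ω => (a ω, b ω)) v P) :
    ∫ ω, inner ℝ (a ω) (v ω) * inner ℝ (b ω) (v ω) ∂P
      = 1 / (m : ℝ) * ∫ ω, inner ℝ (a ω) (b ω) ∂P := by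
  have hprob : IsProbabilityMeasure (sphereUniform m) := by
    rw [← hlaw]; exact Measure.isProbabilityMeasure_map hv.aemeasurable
  have hab_int : ∀ k l, Integrable (fun ω => a ω k * b ω l) P := by
    intro k l
    refine Integrable.of_bound (C := Ca * Cb) (by fun_prop) (ae_of_all _ fun ω => ?_)
    rw [norm_mul]
    have h1 := (PiLp.norm_apply_le (a ω) k).trans (hab ω)
    have h2 := (PiLp.norm_apply_le (b ω) l).trans (hbb ω)
    exact mul_le_mul h1 h2 (norm_nonneg _) ((norm_nonneg _).trans h1)
  have hvv_int : ∀ k l, Integrable (fun ω => v ω k * v ω l) P := by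
    intro k l
    have h := integrable_coord_mul_sphereUniform (m := m) k l
    rw [← hlaw] at h
    exact h.comp_measurable hv
  have hvv : ∀ k l, ∫ ω, v ω k * v ω l ∂P = if k = l then 1 / (m : ℝ) else 0 := by
    intro k l
    rw [← integral_coord_mul_sphereUniform, ← hlaw, integral_map hv.aemeasurable (by fun_prop)]
  have hindkl : ∀ k l, IndepFun (fun ω => a ω k * b ω l) (fun ω => v ω k * v ω l) P := by
    intro k l
    exact hind.comp (φ := fun p : Vec m × Vec m => p.1 k * p.2 l)
      (ψ := fun w : Vec m => w k * w l) (by fun_prop) (by fun_prop)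
  have hexp : ∀ ω, inner ℝ (a ω) (v ω) * inner ℝ (b ω) (v ω)
      = ∑ k, ∑ l, (a ω k * b ω l) * (v ω k * v ω l) := by
    intro ω
    simp only [PiLp.inner_apply]
    rw [Finset.sum_mul_sum]
    refine Finset.sum_congr rfl fun k _ => Finset.sum_congr rfl fun l _ => ?_
    simp
    ring
  have hint : ∀ k l, Integrable (fun ω => (a ω k * b ω l) * (v ω k * v ω l)) P :=
    fun k l => (hindkl k l).integrable_mul (hab_int k l) (hvv_int k l)
  simp_rw [hexp]
  rw [integral_finsetSum _ fun k _ => integrable_finsetSum _ fun l _ => hint k l]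
  have hkl : ∀ k l, ∫ ω, (a ω k * b ω l) * (v ω k * v ω l) ∂P
      = if k = l then 1 / (m : ℝ) * ∫ ω, a ω k * b ω l ∂P else 0 := by
    intro k l
    rw [(hindkl k l).integral_fun_mul_eq_mul_integral (hab_int k l).1 (hvv_int k l).1, hvv]
    split_ifs <;> ring
  simp_rw [fun k => integral_finsetSum Finset.univ fun l _ => hint k l, hkl]
  simp only [Finset.sum_ite_eq, Finset.mem_univ, if_true]
  rw [← Finset.mul_sum, ← integral_finsetSum _ fun k _ => hab_int k k]
  congr 2
  ext ω
  simp [PiLp.inner_apply, mul_comm]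

/-! ### The square loss and its gradient estimator -/

/-- The gradient at `y` of the square loss of the data point `d`. -/
noncomputable def lossGrad {m : ℕ} (d : Datum m) (y : Vec m) : Vec m :=
  (inner ℝ d.1 y - d.2) • d.1

/-- The two-point difference quotient is exact, the loss being quadratic. -/
lemma gradEst_eq {m : ℕ} {ε : ℝ} (hε : ε ≠ 0) (d : Datum m) (x u : Vec m) :
    gradEst ε d x u = (m * inner ℝ (lossGrad d x) u) • u := by
  rw [gradEst]
  congr 1
  simp only [sqLoss, lossGrad, inner_add_right, inner_sub_right, real_inner_smul_right,
    real_inner_smul_left]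
  field_simp
  ring

lemma sqLoss_sub_le_inner {m : ℕ} (d : Datum m) (x y : Vec m) :
    sqLoss d x - sqLoss d y ≤ inner ℝ (lossGrad d x) (x - y) := by
  simp only [sqLoss, lossGrad, real_inner_smul_left, inner_sub_right]
  nlinarith [sq_nonneg (inner ℝ d.1 x - inner ℝ d.1 y)]

section Bounds

variable {m : ℕ} {αh αz R : ℝ} {d : Datum m} {x : Vec m}

lemma norm_fst_le_of_mem_dataSet (hd : d ∈ dataSet m αh αz) : ‖d.1‖ ≤ √αh :=
  Real.le_sqrt_of_sq_le hd.1

lemma abs_residual_le (hd : d ∈ dataSet m αh αz) (hx : ‖x‖ ≤ R) :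
    |inner ℝ d.1 x - d.2| ≤ √αh * R + αz := by
  refine (abs_sub _ _).trans (add_le_add ?_ hd.2)
  exact (abs_real_inner_le_norm _ _).trans
    (mul_le_mul (norm_fst_le_of_mem_dataSet hd) hx (norm_nonneg _) (Real.sqrt_nonneg _))

lemma norm_lossGrad_le (hd : d ∈ dataSet m αh αz) (hx : ‖x‖ ≤ R) :
    ‖lossGrad d x‖ ≤ αh * R + √αh * αz := by
  have hα : 0 ≤ αh := (sq_nonneg _).trans hd.1
  rw [lossGrad, norm_smul, Real.norm_eq_abs]
  have h1 := abs_residual_le hd hx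
  calc |inner ℝ d.1 x - d.2| * ‖d.1‖ ≤ (√αh * R + αz) * √αh :=
        mul_le_mul h1 (norm_fst_le_of_mem_dataSet hd) (norm_nonneg _)
          ((abs_nonneg _).trans h1)
    _ = √αh * √αh * R + √αh * αz := by ring
    _ = _ := by rw [Real.mul_self_sqrt hα]

lemma norm_sqLoss_le (hd : d ∈ dataSet m αh αz) (hx : ‖x‖ ≤ R) :
    ‖sqLoss d x‖ ≤ 1 / 2 * (√αh * R + αz) ^ 2 := by
  rw [sqLoss, Real.norm_of_nonneg (by positivity), ← sq_abs (inner ℝ d.1 x - d.2)]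
  gcongr
  exact abs_residual_le hd hx

lemma sqLoss_sub_le (hd : d ∈ dataSet m αh αz) (hx : ‖x‖ ≤ R) (y : Vec m) :
    sqLoss d x - sqLoss d y ≤ (αh * R + √αh * αz) * ‖x - y‖ :=
  (sqLoss_sub_le_inner d x y).trans <| (real_inner_le_norm _ _).trans <|
    mul_le_mul_of_nonneg_right (norm_lossGrad_le hd hx) (norm_nonneg _)

end Bounds

lemma continuous_sqLoss {m : ℕ} : Continuous fun p : Datum m × Vec m => sqLoss p.1 p.2 := by
  unfold sqLoss
  fun_prop

lemma continuous_lossGrad {m : ℕ} : Continuous fun p : Datum m × Vec m => lossGrad p.1 p.2 := by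
  unfold lossGrad
  fun_prop

lemma continuous_gradEst {m : ℕ} (ε : ℝ) :
    Continuous fun p : Datum m × Vec m × Vec m => gradEst ε p.1 p.2.1 p.2.2 := by
  unfold gradEst sqLoss
  fun_prop

section Measurable

variable {m : ℕ} {α : Type*} [MeasurableSpace α] {d : α → Datum m} {x u : α → Vec m}

lemma measurable_sqLoss (hd : Measurable d) (hx : Measurable x) :
    Measurable fun a => sqLoss (d a) (x a) :=
  Measurable.comp (g := fun p : Datum m × Vec m => sqLoss p.1 p.2) (f := fun a => (d a, x a))
    continuous_sqLoss.measurable (hd.prodMk hx)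

lemma measurable_lossGrad (hd : Measurable d) (hx : Measurable x) :
    Measurable fun a => lossGrad (d a) (x a) :=
  Measurable.comp (g := fun p : Datum m × Vec m => lossGrad p.1 p.2) (f := fun a => (d a, x a))
    continuous_lossGrad.measurable (hd.prodMk hx)

lemma measurable_gradEst (ε : ℝ) (hd : Measurable d) (hx : Measurable x) (hu : Measurable u) :
    Measurable fun a => gradEst ε (d a) (x a) (u a) :=
  Measurable.comp (g := fun p : Datum m × Vec m × Vec m => gradEst ε p.1 p.2.1 p.2.2)
    (f := fun a => (d a, x a, u a)) (continuous_gradEst ε).measurable (hd.prodMk (hx.prodMk hu))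

end Measurable

/-! ### Measurability and independence of the runs -/

section Run

variable {n m : ℕ} {W : Matrix (Fin n) (Fin n) ℝ} {K : Set (Vec m)} {A : Adversary n m}
  {η ε ξ : ℝ} {x₁ : Fin n → Vec m}

lemma run_congr {t : ℕ} {u u' : ℕ → Fin n → Vec m} (h : ∀ s < t, u s = u' s) :
    run W K A η ε ξ x₁ u t = run W K A η ε ξ x₁ u' t := by
  induction t with
  | zero => rfl
  | succ t ih =>
    have h1 := ih fun s hs => h s (hs.trans t.lt_succ_self)
    have h2 := h t t.lt_succ_self
    simp only [run, h1, h2]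

lemma measurable_run (hA : ∀ i t, Measurable (A i t)) (hK : Measurable (proj ((1 - ξ) • K)))
    (t : ℕ) : Measurable fun u : ℕ → Fin n → Vec m => run W K A η ε ξ x₁ u t := by
  induction t with
  | zero => exact measurable_const
  | succ t ih =>
    have hx : ∀ j, Measurable fun u : ℕ → Fin n → Vec m => (run W K A η ε ξ x₁ u t).1 j :=
      fun j => (measurable_pi_apply j).comp ih.fst
    have hpast : ∀ j, Measurable fun u : ℕ → Fin n → Vec m => (run W K A η ε ξ x₁ u t).2 j :=
      fun j => (measurable_pi_apply j).comp ih.snd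
    have hd : ∀ j, Measurable fun u : ℕ → Fin n → Vec m =>
        A j t ((run W K A η ε ξ x₁ u t).2 j) := fun j => (hA j t).comp (hpast j)
    have hu : ∀ j, Measurable fun u : ℕ → Fin n → Vec m => u t j := fun j => by fun_prop
    refine Measurable.prodMk (measurable_pi_lambda _ fun i => hK.comp ?_)
      (measurable_pi_lambda _ fun i => measurable_pi_lambda _ fun s => ?_)
    · have hg : ∀ j, Measurable fun u : ℕ → Fin n → Vec m =>
          gradEst ε (A j t ((run W K A η ε ξ x₁ u t).2 j)) ((run W K A η ε ξ x₁ u t).1 j) (u t j) :=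
        fun j => measurable_gradEst ε (hd j) (hx j) (hu j)
      exact Finset.measurable_sum _ fun j _ => ((hx j).sub ((hg j).const_smul η)).const_smul (W i j)
    · refine Fin.lastCases ?_ (fun s => ?_) s
      · simpa only [Fin.snoc_last] using (hd i).prodMk (hx i)
      · simp only [Fin.snoc_castSucc]
        exact (measurable_pi_apply s).comp (hpast i)

/-- The state before round `t` is a function of the directions of the earlier rounds, so it is
independent of the directions of round `t`. -/
lemma indepFun_run {Ω : Type*} [MeasurableSpace Ω] {P : Measure Ω}
    {u : ℕ → Fin n → Ω → Vec m} (hu : IsUniformDirections P u)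
    (hA : ∀ i t, Measurable (A i t)) (hK : Measurable (proj ((1 - ξ) • K))) (t : ℕ) (j : Fin n) :
    IndepFun (fun ω => run W K A η ε ξ x₁ (fun s k => u s k ω) t) (u t j) P := by
  classical
  let S : Finset (ℕ × Fin n) := Finset.range t ×ˢ Finset.univ
  let T : Finset (ℕ × Fin n) := {(t, j)}
  have hST : Disjoint S T := by simp [S, T]
  have h := hu.indep.indepFun_finset S T hST fun p => hu.measurable p.1 p.2
  let ext : (S → Vec m) → ℕ → Fin n → Vec m :=
    fun w s k => if hs : (s, k) ∈ S then w ⟨(s, k), hs⟩ else 0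
  have hext : Measurable ext := by
    refine measurable_pi_lambda _ fun s => measurable_pi_lambda _ fun k => ?_
    by_cases hs : (s, k) ∈ S
    · simpa only [ext, hs, dif_pos] using measurable_pi_apply _
    · simpa only [ext, hs, dif_neg, not_false_eq_true] using measurable_const
  have hT : Measurable fun w : T → Vec m => w ⟨(t, j), Finset.mem_singleton_self _⟩ :=
    measurable_pi_apply _
  have h' := h.comp (φ := fun w => run W K A η ε ξ x₁ (ext w) t)
    (ψ := fun w : T → Vec m => w ⟨(t, j), Finset.mem_singleton_self _⟩)
    ((measurable_run hA hK t).comp hext) hT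
  convert! h' using 1
  funext ω
  refine run_congr fun s hs => ?_
  funext k
  have hmem : (s, k) ∈ S := by simpa [S] using hs
  simp [ext, hmem]

end Run

/-! ### Regret of a random run -/

/-- The properties of the random predictions `x` and data `d` of a run that the regret bound
rests on: the update rule, the bounds on the data, and the independence of the directions `u t i`
from the current predictions and data. -/
structure IsBanditRun {n m : ℕ} {Ω : Type*} [MeasurableSpace Ω] (P : Measure Ω)
    (W : Matrix (Fin n) (Fin n) ℝ) (K : Set (Vec m)) (αh αz η ε ξ : ℝ)
    (u x : ℕ → Fin n → Ω → Vec m) (d : ℕ → Fin n → Ω → Datum m) : Prop where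
  zero_mem : ∀ i ω, x 0 i ω ∈ K
  succ_eq : ∀ t i ω, x (t + 1) i ω = proj ((1 - ξ) • K)
    (∑ j, W i j • (x t j ω - η • gradEst ε (d t j ω) (x t j ω) (u t j ω)))
  data_mem : ∀ t i ω, d t i ω ∈ dataSet m αh αz
  measurable_pred : ∀ t i, Measurable (x t i)
  measurable_data : ∀ t i, Measurable (d t i)
  measurable_dir : ∀ t i, Measurable (u t i)
  law_dir : ∀ t i, P.map (u t i) = sphereUniform m
  indep : ∀ t i, IndepFun (fun ω => (d t i ω, x t i ω)) (u t i) P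

/-- What the analysis needs to know about the decision set `K` and about the factor `1 - ξ` by
which it is shrunk. -/
structure IsDecisionSet {m : ℕ} (K : Set (Vec m)) (R ξ : ℝ) : Prop where
  compact : IsCompact K
  convex : Convex ℝ K
  zero_mem : (0 : Vec m) ∈ K
  norm_le : ∀ y ∈ K, ‖y‖ ≤ R
  xi_nonneg : 0 ≤ ξ
  xi_le_one : ξ ≤ 1

namespace IsDecisionSet

variable {m : ℕ} {K : Set (Vec m)} {R ξ : ℝ} (hK : IsDecisionSet K R ξ)
include hK

lemma radius_nonneg : 0 ≤ R := (norm_nonneg _).trans (hK.norm_le 0 hK.zero_mem)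

lemma isClosed_smul : IsClosed ((1 - ξ) • K) := (hK.compact.smul _).isClosed

lemma convex_smul : Convex ℝ ((1 - ξ) • K) := hK.convex.smul _

lemma nonempty_smul : ((1 - ξ) • K).Nonempty := Set.Nonempty.smul_set ⟨0, hK.zero_mem⟩

lemma smul_subset : (1 - ξ) • K ⊆ K := by
  rintro _ ⟨y, hy, rfl⟩
  exact hK.convex.smul_mem_of_zero_mem hK.zero_mem hy
    ⟨by linarith [hK.xi_le_one], by linarith [hK.xi_nonneg]⟩

lemma measurable_proj : Measurable (proj ((1 - ξ) • K)) :=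
  (continuous_proj hK.nonempty_smul hK.isClosed_smul hK.convex_smul).measurable

end IsDecisionSet

/-- Summing a contraction in which the perturbation `c` is contracted as well: this is why the
factor is `σ / (1 - σ)` and not `1 / (1 - σ)`. -/
lemma sum_le_of_contraction {a : ℕ → ℝ} {σ c : ℝ} (h0 : ∀ t, 0 ≤ a t) (hσ0 : 0 ≤ σ)
    (hσ1 : σ < 1) (h : ∀ t, a (t + 1) ≤ σ * (a t + c)) (N : ℕ) :
    ∑ t ∈ Finset.range N, a (t + 1) ≤ σ / (1 - σ) * (a 0 + N * c) := by
  have h1 : ∑ t ∈ Finset.range N, a (t + 1) ≤ σ * (∑ t ∈ Finset.range N, a t + N * c) := by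
    refine (Finset.sum_le_sum fun t _ => h t).trans_eq ?_
    rw [← Finset.mul_sum, Finset.sum_add_distrib]
    simp
  have h2 : ∑ t ∈ Finset.range N, a t ≤ ∑ t ∈ Finset.range N, a (t + 1) + a 0 := by
    rw [← Finset.sum_range_succ', Finset.sum_range_succ]
    linarith [h0 N]
  have h3 : 0 < 1 - σ := by linarith
  rw [div_mul_eq_mul_div, le_div_iff₀ h3]
  nlinarith [mul_le_mul_of_nonneg_left h2 hσ0]

namespace IsBanditRun

variable {n m : ℕ} {Ω : Type*} [MeasurableSpace Ω] {P : Measure Ω}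
  {W : Matrix (Fin n) (Fin n) ℝ} {K : Set (Vec m)} {αh αz η ε ξ R : ℝ}
  {u x : ℕ → Fin n → Ω → Vec m} {d : ℕ → Fin n → Ω → Datum m}

section Pointwise

variable (hr : IsBanditRun P W K αh αz η ε ξ u x d) (hK : IsDecisionSet K R ξ)
include hr hK

lemma mem (t : ℕ) (i : Fin n) (ω : Ω) : x t i ω ∈ K := by
  cases t with
  | zero => exact hr.zero_mem i ω
  | succ t =>
    rw [hr.succ_eq]
    exact hK.smul_subset (proj_spec hK.nonempty_smul hK.isClosed_smul hK.convex_smul _).1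

lemma norm_le (t : ℕ) (i : Fin n) (ω : Ω) : ‖x t i ω‖ ≤ R := hK.norm_le _ (hr.mem hK t i ω)

lemma norm_grad_le (t : ℕ) (i : Fin n) (ω : Ω) :
    ‖lossGrad (d t i ω) (x t i ω)‖ ≤ αh * R + √αh * αz :=
  norm_lossGrad_le (hr.data_mem t i ω) (hr.norm_le hK t i ω)

/-- One round of the algorithm, seen from a point `y` of the shrunken decision set. -/
lemma sum_norm_sq_succ_le {G : Digraph (Fin n)} (hW : IsWeightMatrix G W) {y : Vec m}
    (hy : y ∈ (1 - ξ) • K) (t : ℕ) (ω : Ω) :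
    ∑ i, ‖x (t + 1) i ω - y‖ ^ 2 ≤ ∑ i, (‖x t i ω - y‖ ^ 2
      - 2 * η * inner ℝ (gradEst ε (d t i ω) (x t i ω) (u t i ω)) (x t i ω - y)
      + η ^ 2 * ‖gradEst ε (d t i ω) (x t i ω) (u t i ω)‖ ^ 2) := by
  set l : Fin n → Vec m :=
    fun j => x t j ω - η • gradEst ε (d t j ω) (x t j ω) (u t j ω) with hl
  have hmix : ∀ i, ∑ j, W i j • l j - y = ∑ j, W i j • (l j - y) := by
    intro i
    simp_rw [smul_sub, Finset.sum_sub_distrib, ← Finset.sum_smul, hW.row_sum, one_smul]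
  calc ∑ i, ‖x (t + 1) i ω - y‖ ^ 2 ≤ ∑ i, ‖∑ j, W i j • (l j - y)‖ ^ 2 := by
        gcongr with i
        rw [hr.succ_eq, ← hmix]
        exact norm_proj_sub_le hK.isClosed_smul hK.convex_smul _ hy
    _ ≤ ∑ j, ‖l j - y‖ ^ 2 := hW.sum_norm_sq_mix_le _
    _ = _ := by
        refine Finset.sum_congr rfl fun i _ => ?_
        have h1 : l i - y = (x t i ω - y) - η • gradEst ε (d t i ω) (x t i ω) (u t i ω) := by
          simp only [hl]; exact sub_right_comm _ _ _
        rw [h1, norm_sub_sq_real, norm_smul, real_inner_smul_right, mul_pow, Real.norm_eq_abs,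
          sq_abs, real_inner_comm]
        ring

lemma ae_norm_gradEst_le (hε : ε ≠ 0) :
    ∀ᵐ ω ∂P, ∀ t i, ‖gradEst ε (d t i ω) (x t i ω) (u t i ω)‖
      ≤ m * (αh * R + √αh * αz) := by
  rw [ae_all_iff]; intro t
  rw [ae_all_iff]; intro i
  have h1 : ∀ᵐ ω ∂P, ‖u t i ω‖ = 1 := by
    have := ae_norm_eq_one_sphereUniform m
    rw [← hr.law_dir t i] at this
    exact ae_of_ae_map (hr.measurable_dir t i).aemeasurable this
  filter_upwards [h1] with ω hω
  rw [gradEst_eq hε, norm_smul, hω, mul_one, norm_mul, Real.norm_natCast]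
  gcongr
  refine (norm_inner_le_norm _ _).trans ?_
  rw [hω, mul_one]
  exact hr.norm_grad_le hK t i ω

/-- Contraction of the disagreement in one round: the projection does not increase distances, and
mixing contracts them. -/
lemma spread_succ_le {G : Digraph (Fin n)} (hW : IsWeightMatrix G W) (hσ : sigma₂ W < 1)
    (hη : 0 ≤ η) {B : ℝ} (t : ℕ) (ω : Ω)
    (hg : ∀ i, ‖gradEst ε (d t i ω) (x t i ω) (u t i ω)‖ ≤ B) :
    spread (fun i => x (t + 1) i ω)
      ≤ sigma₂ W * (spread (fun i => x t i ω) + η * (2 * n * B)) := by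
  calc spread (fun i => x (t + 1) i ω)
      ≤ spread (fun i => ∑ j, W i j •
          (x t j ω - η • gradEst ε (d t j ω) (x t j ω) (u t j ω))) := by
        refine spread_le_spread fun i j => ?_
        rw [hr.succ_eq, hr.succ_eq]
        exact norm_proj_sub_proj_le hK.nonempty_smul hK.isClosed_smul hK.convex_smul _ _
    _ ≤ _ := hW.spread_mix_le hσ _
    _ ≤ _ := by
        refine mul_le_mul_of_nonneg_left ?_ (sigma₂_nonneg W)
        refine (spread_sub_smul_le _ _ hη).trans ?_
        gcongr
        exact spread_le_of_norm_le hg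

/-- The accumulated disagreement. The arbitrary initial predictions enter in the first round
without a factor `σ₂ / (1 - σ₂)`, so this round is accounted for by the diameter of `K`. -/
lemma ae_sum_norm_sub_le {G : Digraph (Fin n)} (hW : IsWeightMatrix G W) (hσ : sigma₂ W < 1)
    (hη : 0 ≤ η) (hε : ε ≠ 0) (N : ℕ) (i : Fin n) :
    ∀ᵐ ω ∂P, ∑ t ∈ Finset.range (N + 1), ∑ j, ‖x t i ω - x t j ω‖ ≤
      n * (2 * R) + √n * (sigma₂ W / (1 - sigma₂ W) *
        (2 * n * R + N * (η * (2 * n * (m * (αh * R + √αh * αz)))))) := by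
  filter_upwards [hr.ae_norm_gradEst_le hK hε] with ω hω
  rw [Finset.sum_range_succ', add_comm]
  refine add_le_add ?_ ?_
  · calc ∑ j, ‖x 0 i ω - x 0 j ω‖ ≤ ∑ _j : Fin n, (R + R) := by
          gcongr with j
          exact (norm_sub_le _ _).trans (add_le_add (hr.norm_le hK _ _ _) (hr.norm_le hK _ _ _))
      _ = _ := by simp; ring
  · calc ∑ t ∈ Finset.range N, ∑ j, ‖x (t + 1) i ω - x (t + 1) j ω‖
        ≤ ∑ t ∈ Finset.range N, √n * spread (fun j => x (t + 1) j ω) :=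
          Finset.sum_le_sum fun t _ => sum_norm_sub_le_spread (fun j => x (t + 1) j ω) i
      _ = √n * ∑ t ∈ Finset.range N, spread (fun j => x (t + 1) j ω) := by rw [Finset.mul_sum]
      _ ≤ _ := by
          gcongr
          refine (sum_le_of_contraction (a := fun t => spread (fun j => x t j ω))
            (fun t => spread_nonneg _) (sigma₂_nonneg W) hσ
            (fun t => hr.spread_succ_le hK hW hσ hη t ω (hω t)) N).trans ?_
          have h1 := sub_pos.2 hσ
          have h2 := sigma₂_nonneg W
          gcongr
          exact spread_le_of_norm_le fun j => hr.norm_le hK 0 j ω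

end Pointwise

section Expectation

variable (hr : IsBanditRun P W K αh αz η ε ξ u x d)
include hr

lemma measurable_lossGrad (t : ℕ) (i : Fin n) :
    Measurable fun ω => lossGrad (d t i ω) (x t i ω) :=
  DOLR.measurable_lossGrad (hr.measurable_data t i) (hr.measurable_pred t i)

lemma measurable_gradEst (t : ℕ) (i : Fin n) :
    Measurable fun ω => gradEst ε (d t i ω) (x t i ω) (u t i ω) :=
  DOLR.measurable_gradEst ε (hr.measurable_data t i) (hr.measurable_pred t i)
    (hr.measurable_dir t i)

variable [IsProbabilityMeasure P]

lemma integrable_sqLoss (t : ℕ) (j : Fin n) {y : Ω → Vec m} (hy : Measurable y)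
    (hyR : ∀ ω, ‖y ω‖ ≤ R) : Integrable (fun ω => sqLoss (d t j ω) (y ω)) P :=
  Integrable.of_bound (C := 1 / 2 * (√αh * R + αz) ^ 2)
    (measurable_sqLoss (hr.measurable_data t j) hy).aestronglyMeasurable
    (ae_of_all _ fun ω => norm_sqLoss_le (hr.data_mem t j ω) (hyR ω))

/-- The unit sphere of the zero-dimensional space is empty, so its `sphereUniform` is the zero
measure, which is not the law of any direction. -/
lemma dim_pos (i : Fin n) : 0 < m := by
  by_contra! hm
  obtain rfl : m = 0 := by omega
  have h1 : IsProbabilityMeasure (sphereUniform 0) := by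
    rw [← hr.law_dir 0 i]
    exact Measure.isProbabilityMeasure_map (hr.measurable_dir 0 i).aemeasurable
  have h2 : sphereUniform 0 Set.univ = 0 := by
    rw [sphereUniform_apply .univ]
    simp
  simp [measure_univ] at h2

variable (hK : IsDecisionSet K R ξ)
include hK

lemma integrable_inner_gradEst (hε : ε ≠ 0) (y : Vec m) (t : ℕ) (i : Fin n) :
    Integrable (fun ω => inner ℝ (gradEst ε (d t i ω) (x t i ω) (u t i ω)) (x t i ω - y)) P := by
  refine Integrable.of_bound (C := m * (αh * R + √αh * αz) * (R + ‖y‖))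
    (((hr.measurable_gradEst t i).inner
      ((hr.measurable_pred t i).sub_const y)).aestronglyMeasurable) ?_
  filter_upwards [hr.ae_norm_gradEst_le hK hε] with ω hω
  refine (norm_inner_le_norm _ _).trans ?_
  exact mul_le_mul (hω t i) ((norm_sub_le _ _).trans (by gcongr; exact hr.norm_le hK t i ω))
    (norm_nonneg _) ((norm_nonneg _).trans (hω t i))

lemma integrable_norm_sq_gradEst (hε : ε ≠ 0) (t : ℕ) (i : Fin n) :
    Integrable (fun ω => ‖gradEst ε (d t i ω) (x t i ω) (u t i ω)‖ ^ 2) P := by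
  refine Integrable.of_bound (C := (m * (αh * R + √αh * αz)) ^ 2)
    (((hr.measurable_gradEst t i).norm.pow_const 2).aestronglyMeasurable) ?_
  filter_upwards [hr.ae_norm_gradEst_le hK hε] with ω hω
  rw [norm_pow, norm_norm]
  gcongr
  exact hω t i

lemma integrable_norm_sq_sub (y : Vec m) (t : ℕ) (i : Fin n) :
    Integrable (fun ω => ‖x t i ω - y‖ ^ 2) P := by
  refine Integrable.of_bound (C := (R + ‖y‖) ^ 2)
    ((((hr.measurable_pred t i).sub_const y).norm.pow_const 2).aestronglyMeasurable)
    (ae_of_all _ fun ω => ?_)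
  rw [norm_pow, norm_norm]
  gcongr
  exact (norm_sub_le _ _).trans (by gcongr; exact hr.norm_le hK t i ω)

lemma integrable_inner_lossGrad (y : Vec m) (t : ℕ) (i : Fin n) :
    Integrable (fun ω => inner ℝ (lossGrad (d t i ω) (x t i ω)) (x t i ω - y)) P := by
  refine Integrable.of_bound (C := (αh * R + √αh * αz) * (R + ‖y‖))
    (((hr.measurable_lossGrad t i).inner
      ((hr.measurable_pred t i).sub_const y)).aestronglyMeasurable) (ae_of_all _ fun ω => ?_)
  refine (norm_inner_le_norm _ _).trans ?_
  have h := hr.norm_grad_le hK t i ω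
  exact mul_le_mul h ((norm_sub_le _ _).trans (by gcongr; exact hr.norm_le hK t i ω))
    (norm_nonneg _) ((norm_nonneg _).trans h)

/-- The estimator is unbiased. -/
lemma integral_inner_gradEst (hε : ε ≠ 0) (y : Vec m) (t : ℕ) (i : Fin n) :
    ∫ ω, inner ℝ (gradEst ε (d t i ω) (x t i ω) (u t i ω)) (x t i ω - y) ∂P
      = ∫ ω, inner ℝ (lossGrad (d t i ω) (x t i ω)) (x t i ω - y) ∂P := by
  have hm : (m : ℝ) ≠ 0 := Nat.cast_ne_zero.2 (hr.dim_pos i).ne'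
  have hφ : Measurable fun p : Datum m × Vec m => (lossGrad p.1 p.2, p.2 - y) :=
    (DOLR.measurable_lossGrad measurable_fst measurable_snd).prodMk (measurable_snd.sub_const y)
  have h := integral_inner_mul_inner_sphereUniform (hr.measurable_lossGrad t i)
    ((hr.measurable_pred t i).sub_const y) (hr.measurable_dir t i) (hr.norm_grad_le hK t i)
    (fun ω => (norm_sub_le _ _).trans (add_le_add_left (hr.norm_le hK t i ω) ‖y‖))
    (hr.law_dir t i)
    ((hr.indep t i).comp hφ measurable_id)
  simp_rw [gradEst_eq hε, real_inner_smul_left, mul_assoc]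
  rw [integral_const_mul]
  simp_rw [real_inner_comm (x t i _ - y) (u t i _)] at h ⊢
  rw [h]
  field_simp

/-- The second moment of the estimator grows only linearly with the dimension. -/
lemma integral_norm_sq_gradEst_le (hε : ε ≠ 0) (t : ℕ) (i : Fin n) :
    ∫ ω, ‖gradEst ε (d t i ω) (x t i ω) (u t i ω)‖ ^ 2 ∂P
      ≤ m * (αh * R + √αh * αz) ^ 2 := by
  have hm : (m : ℝ) ≠ 0 := Nat.cast_ne_zero.2 (hr.dim_pos i).ne'
  have hφ : Measurable fun p : Datum m × Vec m => (lossGrad p.1 p.2, lossGrad p.1 p.2) :=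
    (DOLR.measurable_lossGrad measurable_fst measurable_snd).prodMk
      (DOLR.measurable_lossGrad measurable_fst measurable_snd)
  have h := integral_inner_mul_inner_sphereUniform (hr.measurable_lossGrad t i)
    (hr.measurable_lossGrad t i) (hr.measurable_dir t i) (hr.norm_grad_le hK t i)
    (hr.norm_grad_le hK t i) (hr.law_dir t i)
    ((hr.indep t i).comp hφ measurable_id)
  have hu : ∀ᵐ ω ∂P, ‖u t i ω‖ = 1 := by
    have := ae_norm_eq_one_sphereUniform m
    rw [← hr.law_dir t i] at this
    exact ae_of_ae_map (hr.measurable_dir t i).aemeasurable this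
  have h1 : ∫ ω, ‖gradEst ε (d t i ω) (x t i ω) (u t i ω)‖ ^ 2 ∂P
      = ∫ ω, (m : ℝ) ^ 2 * (inner ℝ (lossGrad (d t i ω) (x t i ω)) (u t i ω)
        * inner ℝ (lossGrad (d t i ω) (x t i ω)) (u t i ω)) ∂P := by
    refine integral_congr_ae ?_
    filter_upwards [hu] with ω hω
    rw [gradEst_eq hε, norm_smul, hω, mul_one, Real.norm_eq_abs, sq_abs]
    ring
  rw [h1, integral_const_mul, h]
  have h2 : ∫ ω, inner ℝ (lossGrad (d t i ω) (x t i ω)) (lossGrad (d t i ω) (x t i ω)) ∂P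
      ≤ (αh * R + √αh * αz) ^ 2 := by
    refine (integral_mono_of_nonneg (g := fun _ => (αh * R + √αh * αz) ^ 2)
      (ae_of_all _ fun ω => real_inner_self_nonneg) (integrable_const _)
      (ae_of_all _ fun ω => ?_)).trans_eq (by simp)
    simp only [real_inner_self_eq_norm_sq]
    gcongr
    exact hr.norm_grad_le hK t i ω
  calc (m : ℝ) ^ 2 * (1 / m * ∫ ω, inner ℝ (lossGrad (d t i ω) (x t i ω))
        (lossGrad (d t i ω) (x t i ω)) ∂P)
      = m * ∫ ω, inner ℝ (lossGrad (d t i ω) (x t i ω)) (lossGrad (d t i ω) (x t i ω)) ∂P := by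
        field_simp
    _ ≤ _ := by gcongr

/-- The linearized regret of the nodes at their own predictions, by telescoping the squared
distances to `y`. -/
lemma sum_integral_inner_lossGrad_le {G : Digraph (Fin n)} (hW : IsWeightMatrix G W)
    (hε : ε ≠ 0) {y : Vec m} (hy : y ∈ (1 - ξ) • K) (T : ℕ) :
    2 * η * ∑ t ∈ Finset.range T, ∑ i,
        ∫ ω, inner ℝ (lossGrad (d t i ω) (x t i ω)) (x t i ω - y) ∂P
      ≤ n * (2 * R) ^ 2 + T * (η ^ 2 * (n * (m * (αh * R + √αh * αz) ^ 2))) := by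
  set Φ : ℕ → ℝ := fun t => ∑ i, ∫ ω, ‖x t i ω - y‖ ^ 2 ∂P with hΦ
  set J : ℕ → ℝ := fun t =>
    ∑ i, ∫ ω, inner ℝ (lossGrad (d t i ω) (x t i ω)) (x t i ω - y) ∂P with hJ
  have hyR : ‖y‖ ≤ R := hK.norm_le y (hK.smul_subset hy)
  have hstep : ∀ t, Φ (t + 1) ≤ Φ t - 2 * η * J t
      + η ^ 2 * (n * (m * (αh * R + √αh * αz) ^ 2)) := by
    intro t
    have hi1 := hr.integrable_norm_sq_sub hK y t
    have hi2 := fun i => (hr.integrable_inner_gradEst hK hε y t i).const_mul (2 * η)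
    have hi3 := fun i => (hr.integrable_norm_sq_gradEst hK hε t i).const_mul (η ^ 2)
    have hi : ∀ i, Integrable (fun ω => ‖x t i ω - y‖ ^ 2
        - 2 * η * inner ℝ (gradEst ε (d t i ω) (x t i ω) (u t i ω)) (x t i ω - y)
        + η ^ 2 * ‖gradEst ε (d t i ω) (x t i ω) (u t i ω)‖ ^ 2) P :=
      fun i => ((hi1 i).sub (hi2 i)).add (hi3 i)
    calc Φ (t + 1) = ∫ ω, ∑ i, ‖x (t + 1) i ω - y‖ ^ 2 ∂P :=
          (integral_finsetSum _ fun i _ => hr.integrable_norm_sq_sub hK y (t + 1) i).symm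
      _ ≤ ∫ ω, ∑ i, (‖x t i ω - y‖ ^ 2
            - 2 * η * inner ℝ (gradEst ε (d t i ω) (x t i ω) (u t i ω)) (x t i ω - y)
            + η ^ 2 * ‖gradEst ε (d t i ω) (x t i ω) (u t i ω)‖ ^ 2) ∂P :=
          integral_mono
            (integrable_finsetSum _ fun i _ => hr.integrable_norm_sq_sub hK y (t + 1) i)
            (integrable_finsetSum _ fun i _ => hi i) (hr.sum_norm_sq_succ_le hK hW hy t)
      _ = ∑ i, (∫ ω, ‖x t i ω - y‖ ^ 2 ∂P
            - 2 * η * ∫ ω, inner ℝ (lossGrad (d t i ω) (x t i ω)) (x t i ω - y) ∂P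
            + η ^ 2 * ∫ ω, ‖gradEst ε (d t i ω) (x t i ω) (u t i ω)‖ ^ 2 ∂P) := by
          rw [integral_finsetSum _ fun i _ => hi i]
          refine Finset.sum_congr rfl fun i _ => ?_
          rw [← hr.integral_inner_gradEst hK hε, ← integral_const_mul, ← integral_const_mul,
            ← integral_sub (hi1 i) (hi2 i)]
          exact integral_add ((hi1 i).sub (hi2 i)) (hi3 i)
      _ ≤ ∑ i, (∫ ω, ‖x t i ω - y‖ ^ 2 ∂P
            - 2 * η * ∫ ω, inner ℝ (lossGrad (d t i ω) (x t i ω)) (x t i ω - y) ∂P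
            + η ^ 2 * (m * (αh * R + √αh * αz) ^ 2)) := by
          gcongr with i
          exact hr.integral_norm_sq_gradEst_le hK hε t i
      _ = _ := by
          rw [Finset.sum_add_distrib, Finset.sum_sub_distrib, ← Finset.mul_sum]
          simp only [hΦ, hJ, Finset.sum_const, Finset.card_univ, Fintype.card_fin, nsmul_eq_mul]
          ring
  have htel : ∀ T : ℕ, 2 * η * ∑ t ∈ Finset.range T, J t
      ≤ Φ 0 - Φ T + T * (η ^ 2 * (n * (m * (αh * R + √αh * αz) ^ 2))) := by
    intro T
    induction T with
    | zero => simp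
    | succ T ih =>
      rw [Finset.sum_range_succ, mul_add]
      push_cast
      linarith [hstep T]
  have h0 : Φ 0 ≤ n * (2 * R) ^ 2 := by
    calc Φ 0 ≤ ∑ _i : Fin n, (2 * R) ^ 2 := by
          refine Finset.sum_le_sum fun i _ => ?_
          refine (integral_mono (hr.integrable_norm_sq_sub hK y 0 i)
            (integrable_const ((2 * R) ^ 2)) fun ω => ?_).trans_eq (by simp)
          have h1 : ‖x 0 i ω - y‖ ≤ 2 * R :=
            (norm_sub_le _ _).trans (by linarith [hr.norm_le hK 0 i ω])
          dsimp only
          gcongr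
      _ = _ := by simp
  have hT : 0 ≤ Φ T := Finset.sum_nonneg fun i _ => integral_nonneg fun ω => sq_nonneg _
  linarith [htel T]

/-- Regret against a fixed competitor `y`. The three terms stem from the disagreement of the
nodes, from the linearized regret against `(1 - ξ) y`, and from shrinking `y`. -/
lemma sum_integral_sqLoss_sub_le {G : Digraph (Fin n)} (hW : IsWeightMatrix G W)
    (hσ : sigma₂ W < 1) (hε : ε ≠ 0) (hη : 0 < η) {y : Vec m} (hy : y ∈ K) (N : ℕ)
    (i : Fin n) :
    ∑ t ∈ Finset.range (N + 1), ∑ j, ∫ ω, sqLoss (d t j ω) (x t i ω) ∂P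
      - ∑ t ∈ Finset.range (N + 1), ∑ j, ∫ ω, sqLoss (d t j ω) y ∂P ≤
      (αh * R + √αh * αz) * (n * (2 * R) + √n * (sigma₂ W / (1 - sigma₂ W) *
        (2 * n * R + N * (η * (2 * n * (m * (αh * R + √αh * αz)))))))
      + 1 / (2 * η) * (n * (2 * R) ^ 2
        + (N + 1 : ℕ) * (η ^ 2 * (n * (m * (αh * R + √αh * αz) ^ 2))))
      + (N + 1 : ℕ) * (n * ((αh * R + √αh * αz) * (ξ * R))) := by
  set L := αh * R + √αh * αz with hL
  set y' : Vec m := (1 - ξ) • y with hy'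
  have hy'mem : y' ∈ (1 - ξ) • K := Set.smul_mem_smul_set hy
  have hy'R : ‖y'‖ ≤ R := hK.norm_le _ (hK.smul_subset hy'mem)
  have hL0 : 0 ≤ L := (norm_nonneg _).trans (hr.norm_grad_le hK 0 i (Classical.choice
    (nonempty_of_isProbabilityMeasure P)))
  have hxint : ∀ t j, Integrable (fun ω => ‖x t i ω - x t j ω‖) P := by
    intro t j
    refine Integrable.of_bound (C := R + R)
      (((hr.measurable_pred t i).sub (hr.measurable_pred t j)).norm.aestronglyMeasurable)
      (ae_of_all _ fun ω => ?_)
    rw [norm_norm]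
    exact (norm_sub_le _ _).trans (add_le_add (hr.norm_le hK _ _ _) (hr.norm_le hK _ _ _))
  have hterm : ∀ t j, ∫ ω, sqLoss (d t j ω) (x t i ω) ∂P - ∫ ω, sqLoss (d t j ω) y ∂P
      ≤ L * ∫ ω, ‖x t i ω - x t j ω‖ ∂P
        + ∫ ω, inner ℝ (lossGrad (d t j ω) (x t j ω)) (x t j ω - y') ∂P + L * (ξ * R) := by
    intro t j
    have hI1 := hr.integrable_sqLoss t j (hr.measurable_pred t i) (hr.norm_le hK t i)
    have hI2 := hr.integrable_sqLoss t j (measurable_const (a := y)) fun _ => hK.norm_le y hy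
    have hJ1 := (hxint t j).const_mul L
    have hJ2 := hr.integrable_inner_lossGrad hK y' t j
    rw [← integral_sub hI1 hI2, ← integral_const_mul]
    calc ∫ ω, (sqLoss (d t j ω) (x t i ω) - sqLoss (d t j ω) y) ∂P
        ≤ ∫ ω, (L * ‖x t i ω - x t j ω‖
          + inner ℝ (lossGrad (d t j ω) (x t j ω)) (x t j ω - y') + L * (ξ * R)) ∂P := by
          refine integral_mono (hI1.sub hI2) ((hJ1.add hJ2).add (integrable_const _)) fun ω => ?_
          have h1 := sqLoss_sub_le (hr.data_mem t j ω) (hr.norm_le hK t i ω) (x t j ω)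
          have h2 := sqLoss_sub_le_inner (d t j ω) (x t j ω) y'
          have h3 := sqLoss_sub_le (hr.data_mem t j ω) hy'R y
          have h4 : ‖y' - y‖ ≤ ξ * R := by
            have : y' - y = -(ξ • y) := by rw [hy', sub_smul, one_smul]; abel
            rw [this, norm_neg, norm_smul, Real.norm_of_nonneg hK.xi_nonneg]
            exact mul_le_mul_of_nonneg_left (hK.norm_le y hy) hK.xi_nonneg
          have h5 := mul_le_mul_of_nonneg_left h4 hL0
          rw [← hL] at h1 h3
          dsimp only
          linarith
      _ = _ := by
          rw [← integral_add hJ1 hJ2]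
          refine (integral_add (hJ1.add hJ2) (integrable_const _)).trans ?_
          simp
  have hsum : ∑ t ∈ Finset.range (N + 1), ∑ j, ∫ ω, sqLoss (d t j ω) (x t i ω) ∂P
      - ∑ t ∈ Finset.range (N + 1), ∑ j, ∫ ω, sqLoss (d t j ω) y ∂P
      ≤ L * ∑ t ∈ Finset.range (N + 1), ∑ j, ∫ ω, ‖x t i ω - x t j ω‖ ∂P
        + ∑ t ∈ Finset.range (N + 1), ∑ j,
          ∫ ω, inner ℝ (lossGrad (d t j ω) (x t j ω)) (x t j ω - y') ∂P
        + (N + 1 : ℕ) * (n * (L * (ξ * R))) := by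
    have e : ((N + 1 : ℕ) : ℝ) * (n * (L * (ξ * R)))
        = ∑ _t ∈ Finset.range (N + 1), ∑ _j : Fin n, L * (ξ * R) := by simp
    rw [e]
    simp only [Finset.mul_sum, ← Finset.sum_add_distrib, ← Finset.sum_sub_distrib]
    exact Finset.sum_le_sum fun t _ => Finset.sum_le_sum fun j _ => hterm t j
  have hcons : ∑ t ∈ Finset.range (N + 1), ∑ j, ∫ ω, ‖x t i ω - x t j ω‖ ∂P
      ≤ n * (2 * R) + √n * (sigma₂ W / (1 - sigma₂ W) *
        (2 * n * R + N * (η * (2 * n * (m * L))))) := by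
    have e : ∑ t ∈ Finset.range (N + 1), ∑ j, ∫ ω, ‖x t i ω - x t j ω‖ ∂P
        = ∫ ω, ∑ t ∈ Finset.range (N + 1), ∑ j, ‖x t i ω - x t j ω‖ ∂P := by
      rw [integral_finsetSum _ fun t _ => integrable_finsetSum _ fun j _ => hxint t j]
      exact Finset.sum_congr rfl fun t _ => (integral_finsetSum _ fun j _ => hxint t j).symm
    rw [e]
    refine (integral_mono_ae (integrable_finsetSum _ fun t _ =>
      integrable_finsetSum _ fun j _ => hxint t j) (integrable_const _)
      (hr.ae_sum_norm_sub_le hK hW hσ hη.le hε N i)).trans_eq ?_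
    simp [hL]
  have hlin := hr.sum_integral_inner_lossGrad_le hK hW hε hy'mem (N + 1)
  have hlin' := mul_le_mul_of_nonneg_left hlin (a := 1 / (2 * η)) (by positivity)
  rw [← mul_assoc, one_div_mul_cancel (by positivity), one_mul] at hlin'
  refine hsum.trans (add_le_add (add_le_add ?_ hlin') le_rfl)
  exact mul_le_mul_of_nonneg_left hcons hL0

end Expectation

end IsBanditRun

/-! ### The regret of the algorithm -/

/-- The predictions and data generated by the algorithm form a run in the sense of
`IsBanditRun`. -/
lemma isBanditRun_of_algorithm {n m : ℕ} {Ω : Type*} [MeasurableSpace Ω] {P : Measure Ω}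
    {W : Matrix (Fin n) (Fin n) ℝ} {K : Set (Vec m)} {A : Adversary n m}
    {αh αz η ε ξ R : ℝ} {x₁ : Fin n → Vec m}
    {u x : ℕ → Fin n → Ω → Vec m} {d : ℕ → Fin n → Ω → Datum m}
    (hK : IsDecisionSet K R ξ) (hA : ∀ i t, Measurable (A i t))
    (hAd : ∀ i t H, A i t H ∈ dataSet m αh αz) (hx₁ : ∀ i, x₁ i ∈ K)
    (hu : IsUniformDirections P u)
    (hx : ∀ t i ω, x t i ω = prediction W K A η ε ξ x₁ (fun s k => u s k ω) t i)
    (hd : ∀ t i ω, d t i ω = datum W K A η ε ξ x₁ (fun s k => u s k ω) t i) :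
    IsBanditRun P W K αh αz η ε ξ u x d := by
  have hmap : Measurable fun ω => fun s k => u s k ω :=
    measurable_pi_lambda _ fun s => measurable_pi_lambda _ fun k => hu.measurable s k
  have hproj := hK.measurable_proj
  -- the data and the prediction of node `i`, as functions of the state before round `t`
  have hφ : ∀ t i, Measurable fun p : (Fin n → Vec m) × (Fin n → History m t) =>
      (A i t (p.2 i), p.1 i) := fun t i =>
    ((hA i t).comp ((measurable_pi_apply i).comp measurable_snd)).prodMk
      ((measurable_pi_apply i).comp measurable_fst)
  have heq : ∀ t i, (fun ω => (d t i ω, x t i ω))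
      = (fun p : (Fin n → Vec m) × (Fin n → History m t) => (A i t (p.2 i), p.1 i)) ∘
        fun ω => run W K A η ε ξ x₁ (fun s k => u s k ω) t := by
    intro t i
    funext ω
    rw [hx, hd]
    rfl
  have hmeas : ∀ t i, Measurable fun ω => (d t i ω, x t i ω) := by
    intro t i
    rw [heq]
    exact (hφ t i).comp ((measurable_run hA hproj t).comp hmap)
  refine ⟨fun i ω => ?_, fun t i ω => ?_, fun t i ω => ?_, fun t i => (hmeas t i).snd,
    fun t i => (hmeas t i).fst, hu.measurable, hu.law, fun t i => ?_⟩
  · rw [hx]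
    exact hx₁ i
  · simp only [hx, hd]
    rfl
  · rw [hd]
    exact hAd _ _ _
  · rw [heq]
    exact (indepFun_run hu hA hproj t i).comp (hφ t i) measurable_id

/-! ### The order of the regret bound -/

/-- Balancing the terms of the regret bound with `η = 1 / √T` and `ξ = 1 / (√T r)`. -/
lemma regret_terms_le {n m N : ℕ} (hm : 1 ≤ m) {σ r R L q η ξ : ℝ} (hσ0 : 0 ≤ σ) (hσ1 : σ < 1)
    (hr : 0 < r) (hR : 0 ≤ R) (hL : 0 ≤ L) (hq : q = √((N + 1 : ℕ) : ℝ)) (hη : η = 1 / q)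
    (hξ : ξ = 1 / q / r) :
    L * (n * (2 * R) + √n * (σ / (1 - σ) *
        (2 * n * R + N * (η * (2 * n * (m * L))))))
      + 1 / (2 * η) * (n * (2 * R) ^ 2 + (N + 1 : ℕ) * (η ^ 2 * (n * (m * L ^ 2))))
      + (N + 1 : ℕ) * (n * (L * (ξ * R)))
    ≤ 4 * boundFactor σ n m r R L * q := by
  have hq1 : 1 ≤ q := by
    rw [hq, Real.one_le_sqrt]
    exact_mod_cast Nat.le_add_left 1 N
  have hqsq : ((N + 1 : ℕ) : ℝ) = q ^ 2 := by rw [hq, Real.sq_sqrt (Nat.cast_nonneg _)]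
  have hN : (N : ℝ) ≤ q ^ 2 := by rw [← hqsq]; push_cast; linarith
  have hm1 : (1 : ℝ) ≤ m := by exact_mod_cast hm
  have hn0 : (0 : ℝ) ≤ n := Nat.cast_nonneg n
  set s := σ / (1 - σ) with hs
  have hs0 : 0 ≤ s := div_nonneg hσ0 (by linarith)
  have hpow : (n : ℝ) ^ (3 / 2 : ℝ) = n * √n := by
    rw [show (3 / 2 : ℝ) = 1 + 1 / 2 by norm_num,
      Real.rpow_add_of_nonneg hn0 (by norm_num) (by norm_num), Real.rpow_one, Real.sqrt_eq_rpow]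
  have hq0 : 0 < q := by linarith
  have hA1 : L * (n * (2 * R)) ≤ n * (m * L ^ 2 + R ^ 2) * q := by
    have h1 : 2 * (L * R) ≤ m * L ^ 2 + R ^ 2 := by
      nlinarith [sq_nonneg (L - R), mul_le_mul_of_nonneg_right hm1 (sq_nonneg L)]
    calc L * (n * (2 * R)) = n * (2 * (L * R)) := by ring
      _ ≤ n * (m * L ^ 2 + R ^ 2) := by gcongr
      _ ≤ _ := le_mul_of_one_le_right (by positivity) hq1
  have hA2 : L * (√n * (s * (2 * n * R + N * (η * (2 * n * (m * L))))))
      ≤ 2 * (s * (n * √n) * (m * L ^ 2 + L * R)) * q := by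
    have h1 : N * η ≤ q := by
      rw [hη, mul_one_div, div_le_iff₀ hq0]
      linarith
    have h2 : 2 * n * R + N * (η * (2 * n * (m * L))) ≤ 2 * n * (R * q) + q * (2 * n * (m * L)) := by
      rw [← mul_assoc (N : ℝ)]
      gcongr
      exact le_mul_of_one_le_right hR hq1
    calc L * (√n * (s * (2 * n * R + N * (η * (2 * n * (m * L))))))
        ≤ L * (√n * (s * (2 * n * (R * q) + q * (2 * n * (m * L))))) := by gcongr
      _ = _ := by ring
  have hB : 1 / (2 * η) * (n * (2 * R) ^ 2 + q ^ 2 * (η ^ 2 * (n * (m * L ^ 2))))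
      = n * (2 * R ^ 2 + m * L ^ 2 / 2) * q := by
    rw [hη]
    field_simp
  have hC : q ^ 2 * (n * (L * (ξ * R))) = n * (L * R / r) * q := by
    rw [hξ]; field_simp
  rw [hqsq, hB, hC, mul_add, boundFactor, hpow, ← hs]
  have hp1 : 0 ≤ s * (n * √n) * (m * L ^ 2 + L * R) * q := by positivity
  have hp2 : 0 ≤ n * (m * L ^ 2) * q := by positivity
  have hp3 : 0 ≤ n * R ^ 2 * q := by positivity
  have hp4 : 0 ≤ n * (L * R / r) * q := by positivity
  nlinarith

lemma boundFactor_le {r R c σ L : ℝ} {n m : ℕ} (hr : 0 < r) (hrR : r ≤ R) (hc : 0 < c)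
    (hm : 1 ≤ m) (hσ0 : 0 ≤ σ) (hσ1 : σ < 1) (hL : c ≤ L) (hn : c ≤ √n * (σ / (1 - σ))) :
    boundFactor σ n m r R L ≤
      (1 / c + R / c ^ 2 + 1 / c * (1 / c + R ^ 2 / c ^ 3 + R / r / c ^ 2)) *
        (σ / (1 - σ) * (n : ℝ) ^ (3 / 2 : ℝ) * (m : ℝ) ^ 2 * L ^ 3) := by
  have hm1 : (1 : ℝ) ≤ m := by exact_mod_cast hm
  have hn0 : (0 : ℝ) ≤ n := Nat.cast_nonneg n
  have hR : 0 < R := hr.trans_le hrR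
  have hL0 : 0 < L := hc.trans_le hL
  set s := σ / (1 - σ) with hs
  have hs0 : 0 ≤ s := div_nonneg hσ0 (by linarith)
  have hpow : (n : ℝ) ^ (3 / 2 : ℝ) = n * √n := by
    rw [show (3 / 2 : ℝ) = 1 + 1 / 2 by norm_num,
      Real.rpow_add_of_nonneg hn0 (by norm_num) (by norm_num), Real.rpow_one, Real.sqrt_eq_rpow]
  set M : ℝ := (m : ℝ) ^ 2 * L ^ 3 with hM
  have hmm : (m : ℝ) ≤ m ^ 2 := by nlinarith
  have hm2 : (1 : ℝ) ≤ (m : ℝ) ^ 2 := hm1.trans hmm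
  have h1 : m * L ^ 2 ≤ 1 / c * M := by
    rw [hM, one_div, ← div_eq_inv_mul, le_div_iff₀ hc]
    calc m * L ^ 2 * c ≤ m ^ 2 * L ^ 2 * L := by gcongr
      _ = _ := by ring
  have h2 : L ≤ 1 / c ^ 2 * M := by
    rw [hM, one_div, ← div_eq_inv_mul, le_div_iff₀ (by positivity)]
    calc L * c ^ 2 ≤ L * L ^ 2 := by gcongr
      _ = 1 * L ^ 3 := by ring
      _ ≤ _ := by gcongr
  have h3 : 1 ≤ 1 / c ^ 3 * M := by
    rw [hM, one_div, ← div_eq_inv_mul, le_div_iff₀ (by positivity)]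
    calc 1 * c ^ 3 ≤ 1 * L ^ 3 := by gcongr
      _ ≤ _ := by gcongr
  have h4 : (n : ℝ) ≤ 1 / c * (s * (n * √n)) := by
    rw [one_div, ← div_eq_inv_mul, le_div_iff₀ hc]
    calc n * c ≤ n * (√n * s) := by gcongr
      _ = _ := by ring
  rw [boundFactor, hpow, ← hs]
  calc s * (n * √n) * (m * L ^ 2 + L * R) + n * (m * L ^ 2 + R ^ 2 + L * R / r)
      = s * (n * √n) * (m * L ^ 2 + L * R) + n * (m * L ^ 2 + 1 * R ^ 2 + L * (R / r)) := by ring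
    _ ≤ s * (n * √n) * (1 / c * M + 1 / c ^ 2 * M * R)
        + 1 / c * (s * (n * √n)) *
          (1 / c * M + 1 / c ^ 3 * M * R ^ 2 + 1 / c ^ 2 * M * (R / r)) := by gcongr
    _ = _ := by rw [hM]; ring

end DOLR

theorem theorem3 :
    ∃ C : ℝ, 0 < C ∧
    -- the regret bound, with the absolute constant `C`
    (∀ (n m : ℕ) (G : Digraph (Fin n)) (W : Matrix (Fin n) (Fin n) ℝ),
      DOLR.StronglyConnected G → DOLR.IsWeightMatrix G W →
      ((∀ i, 0 < W i i) → DOLR.sigma₂ W < 1) ∧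
      (DOLR.sigma₂ W < 1 →
        ∀ (αh αz r R L : ℝ) (K : Set (DOLR.Vec m)) (A : DOLR.Adversary n m)
          (x₁ : Fin n → DOLR.Vec m) (T : ℕ) (ε : ℝ) (ξ : ℝ) (η : ℝ)
          (Ω : Type*) [MeasurableSpace Ω] (P : Measure Ω) [IsProbabilityMeasure P]
          (u : ℕ → Fin n → Ω → DOLR.Vec m)
          (x : ℕ → Fin n → Ω → DOLR.Vec m) (d : ℕ → Fin n → Ω → DOLR.Datum m),
        L = αh * R + √αh * αz →
        0 < r → r ≤ R →
        IsCompact K → Convex ℝ K →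
        Metric.closedBall 0 r ⊆ K → K ⊆ Metric.closedBall 0 R →
        (∀ i t, Measurable (A i t)) →
        (∀ i t H, A i t H ∈ DOLR.dataSet m αh αz) →
        (∀ i, x₁ i ∈ K) →
        ⌈1 / r ^ 2⌉₊ ≤ T →
        -- the parameters `β = 1/2`, `κ = 1`, `ε = 1/√T`, `ξ = ε/r`; step size `η = 1/(κ T^β)`
        ε = 1 / √(T : ℝ) → ξ = ε / r → η = 1 / (1 * (T : ℝ) ^ (1 / 2 : ℝ)) →
        DOLR.IsUniformDirections P u →
        -- the random predictions and the random data produced by the algorithm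
        (∀ t i ω, x t i ω = DOLR.prediction W K A η ε ξ x₁ (fun s k => u s k ω) t i) →
        (∀ t i ω, d t i ω = DOLR.datum W K A η ε ξ x₁ (fun s k => u s k ω) t i) →
        (∀ t i j, Integrable (fun ω => DOLR.sqLoss (d t j ω) (x t i ω)) P) ∧
        (∀ t j, ∀ y ∈ K, Integrable (fun ω => DOLR.sqLoss (d t j ω) y) P) ∧
        ∀ i, DOLR.regret P K x d T i ≤
          C * DOLR.boundFactor (DOLR.sigma₂ W) n m r R L * √(T : ℝ))) ∧
    -- the order of the factor of `√T`
    (∀ r R c : ℝ, 0 < r → r ≤ R → 0 < c →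
      ∃ C' : ℝ, 0 < C' ∧ ∀ (n m : ℕ) (σ L : ℝ), 1 ≤ m → 0 ≤ σ → σ < 1 →
        c ≤ L → c ≤ √(n : ℝ) * (σ / (1 - σ)) →
        C * DOLR.boundFactor σ n m r R L ≤
          C' * (σ / (1 - σ) * (n : ℝ) ^ (3 / 2 : ℝ) * (m : ℝ) ^ 2 * L ^ 3)) := by
  refine ⟨4, by norm_num, fun n m G W hG hW => ⟨DOLR.sigma₂_lt_one hG hW, ?_⟩, ?_⟩
  · intro hσ αh αz r R L K A x₁ T ε ξ η Ω _ P _ u x d hL hr hrR hKc hKconv hrK hKR hA hAd hx₁ hT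
      hε hξ hη hu hx hd
    have hr2 : (0 : ℝ) < 1 / r ^ 2 := by positivity
    have hTr : 1 / r ^ 2 ≤ (T : ℝ) := (Nat.le_ceil _).trans (by exact_mod_cast hT)
    have hT0 : (0 : ℝ) < T := hr2.trans_le hTr
    have hq0 : 0 < √(T : ℝ) := Real.sqrt_pos.2 hT0
    have hη' : η = 1 / √(T : ℝ) := by rw [hη, one_mul, Real.sqrt_eq_rpow]
    have hε0 : 0 < ε := by rw [hε]; positivity
    -- the lower bound on `T` says that `ε ≤ r`
    have hεr : ε ≤ r := by
      rw [hε, div_le_iff₀ hq0, ← div_le_iff₀' hr]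
      exact Real.le_sqrt_of_sq_le (by simpa using hTr)
    have hK : DOLR.IsDecisionSet K R ξ :=
      { compact := hKc
        convex := hKconv
        zero_mem := hrK (Metric.mem_closedBall_self hr.le)
        norm_le := fun y hy => mem_closedBall_zero_iff.1 (hKR hy)
        xi_nonneg := by rw [hξ]; positivity
        xi_le_one := by rw [hξ]; exact (div_le_one hr).2 hεr }
    have hrun := DOLR.isBanditRun_of_algorithm hK hA hAd hx₁ hu hx hd
    refine ⟨fun t i j => hrun.integrable_sqLoss t j (hrun.measurable_pred t i) (hrun.norm_le hK t i),
      fun t j y hy => hrun.integrable_sqLoss t j measurable_const fun _ => hK.norm_le y hy,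
      fun i => ?_⟩
    obtain ⟨N, rfl⟩ : ∃ N, T = N + 1 := Nat.exists_eq_succ_of_ne_zero (by rintro rfl; simp at hT0)
    have hL0 : 0 ≤ L := by
      obtain ⟨ω⟩ := nonempty_of_isProbabilityMeasure P
      exact hL ▸ (norm_nonneg _).trans (hrun.norm_grad_le hK 0 i ω)
    have hterms := DOLR.regret_terms_le (n := n) (hrun.dim_pos i) (DOLR.sigma₂_nonneg W) hσ hr
      hK.radius_nonneg hL0 rfl hη' (hξ.trans (by rw [hε]))
    -- bounding the infimum from below by every one of its values needs no minimizer
    rw [DOLR.regret, sub_le_comm]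
    refine le_csInf (Set.Nonempty.image _ ⟨0, hK.zero_mem⟩) ?_
    rintro _ ⟨y, hy, rfl⟩
    have h := hrun.sum_integral_sqLoss_sub_le hK hW hσ hε0.ne' (by rw [hη']; positivity) hy N i
    rw [← hL] at h
    dsimp only
    linarith
  · intro r R c hr hrR hc
    have hR : 0 < R := hr.trans_le hrR
    refine ⟨4 * (1 / c + R / c ^ 2 + 1 / c * (1 / c + R ^ 2 / c ^ 3 + R / r / c ^ 2)),
      by positivity, fun n m σ L hm hσ0 hσ1 hL hn => ?_⟩
    rw [mul_assoc 4]
    exact mul_le_mul_of_nonneg_left (DOLR.boundFactor_le hr hrR hc hm hσ0 hσ1 hL hn) (by norm_num)
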